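/- Let $G=\mathrm{PSL}_2(\mathbb{C})$ act on the complex projective line $\mathbb{P}^1$, equipped with its standard (chordal) metric $\mathrm{dist}([v],[w])=\frac{|v_1w_2-v_2w_1|}{\|v\|\,\|w\|}$, and let $\|g\|$ denote the operator norm of a matrix in $\mathrm{SL}_2(\mathbb{C})$ representing $g\in G$, for the standard Hermitian norm on $\mathbb{C}^2$. For a Borel probability measure $\mu$ on $G$ and a Borel probability measure $m$ on $\mathbb{P}^1$, let $(f_\mu)_*m=\mu*m$ be the image of $\mu\otimes m$ under $(g,x)\mapsto g\cdot x$, and let $(f_\mu^n)_*m=\mu^{*n}*m$, where $\mu^{*n}$ is the $n$-th convolution power of $\mu$ (with $\mu^{*0}=\delta_{\mathrm{id}}$). Call $m$ $\mu$-stationary if $\mu*m=m$. Call $\mu$ non-elementary if no non-empty finite subset of $\mathbb{P}^1$ is preserved by every element of $\mathrm{supp}(\mu)$ and the semigroup generated by $\mathrm{supp}(\mu)$ is not relatively compact in $G$. Theorem. Let $\mu$ be a non-elementary Borel probability measure on $G$ such that $\int_G(\log\|g\|)^{1+\epsilon}\,d\mu(g)<+\infty$ for some $\epsilon>0$. Then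 $\mu$ admits a unique stationary probability measure $\nu$ on $\mathbb{P}^1$, and there is a constant $0<\gamma<1$ such that for every $0<\beta\le 1$ there is a constant $A_\beta>0$ such that, for every $a\in\mathbb{P}^1$, every function $\varphi:\mathbb{P}^1\to\mathbb{C}$ that is Hölder continuous of exponent $\beta$ (Lipschitz if $\beta=1$), and every integer $n\ge 0$, $$\big|\big\langle (f_\mu^n)_*\delta_a-\nu,\varphi\big\rangle\big|\le A_\beta\,\|\varphi\|_{\mathcal C^\beta}\,\gamma^{\beta n},$$ where $\|\varphi\|_{\mathcal C^\beta}=\sup|\varphi|+\sup_{x\neq y}\frac{|\varphi(x)-\varphi(y)|}{\mathrm{dist}(x,y)^\beta}$. Here $\gamma$ depends on neither $\beta$, $a$, $\varphi$ nor $n$, and $A_\beta$ does not depend on $a$, $\varphi$ or $n$. -/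

import Mathlib

open MeasureTheory
open scoped NNReal MatrixGroups LinearAlgebra.Projectivization

noncomputable section

namespace RandomProducts

/-- The group `PSL₂(ℂ) = SL₂(ℂ) / {±1}`; it carries the quotient topology. -/
abbrev G : Type := PSL(2, ℂ)

/-- The complex projective line, i.e. the set of complex lines through the origin of `ℂ²`, on which
`PSL₂(ℂ)` acts by `[A] • [v] = [A v]`. -/
abbrev P1 : Type := ℙ ℂ (Fin 2 → ℂ)

/-- The Borel σ-algebra of `PSL₂(ℂ)`. -/
instance : MeasurableSpace G := borel G

instance : BorelSpace G := ⟨rfl⟩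

/-- The hermitian norm on `ℂ²`. -/
def hnorm (v : Fin 2 → ℂ) : ℝ := Real.sqrt (‖v 0‖ ^ 2 + ‖v 1‖ ^ 2)

/-- The chordal distance `|v ∧ w| / (‖v‖ ‖w‖)` between the lines spanned by `v` and `w`. -/
def chord (v w : Fin 2 → ℂ) : ℝ := ‖v 0 * w 1 - v 1 * w 0‖ / (hnorm v * hnorm w)

theorem hnorm_pos {v : Fin 2 → ℂ} (hv : v ≠ 0) : 0 < hnorm v := by
  apply Real.sqrt_pos.2
  by_contra h
  apply hv
  have h0 : ‖v 0‖ ^ 2 = 0 := by nlinarith [sq_nonneg ‖v 0‖, sq_nonneg ‖v 1‖]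
  have h1 : ‖v 1‖ ^ 2 = 0 := by nlinarith [sq_nonneg ‖v 0‖, sq_nonneg ‖v 1‖]
  ext i
  fin_cases i
  · simpa using h0
  · simpa using h1

theorem hnorm_sq (v : Fin 2 → ℂ) : hnorm v ^ 2 = ‖v 0‖ ^ 2 + ‖v 1‖ ^ 2 :=
  Real.sq_sqrt (by positivity)

theorem hnorm_smul (a : ℂ) (v : Fin 2 → ℂ) : hnorm (a • v) = ‖a‖ * hnorm v := by
  have : ‖(a • v) 0‖ ^ 2 + ‖(a • v) 1‖ ^ 2 = ‖a‖ ^ 2 * (‖v 0‖ ^ 2 + ‖v 1‖ ^ 2) := by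
    simp only [Pi.smul_apply, smul_eq_mul, norm_mul]; ring
  rw [hnorm, this, Real.sqrt_mul (by positivity), Real.sqrt_sq (norm_nonneg a), hnorm]

theorem chord_self (v : Fin 2 → ℂ) : chord v v = 0 := by
  simp [chord, mul_comm]

theorem chord_comm (v w : Fin 2 → ℂ) : chord v w = chord w v := by
  unfold chord
  rw [← norm_neg (v 0 * w 1 - v 1 * w 0), mul_comm (hnorm v)]
  congr 2
  ring

theorem chord_smul (v w : Fin 2 → ℂ) {a : ℂ} (ha : a ≠ 0) : chord (a • v) w = chord v w := by
  unfold chord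
  rw [hnorm_smul]
  have h : (a • v) 0 * w 1 - (a • v) 1 * w 0 = a * (v 0 * w 1 - v 1 * w 0) := by
    simp only [Pi.smul_apply, smul_eq_mul]; ring
  rw [h, norm_mul, mul_assoc, mul_div_mul_left _ _ (norm_ne_zero_iff.2 ha)]

theorem hnorm_inner_le (v w : Fin 2 → ℂ) :
    ‖star (v 0) * w 0 + star (v 1) * w 1‖ ≤ hnorm v * hnorm w := by
  have h1 : ‖star (v 0) * w 0 + star (v 1) * w 1‖ ≤ ‖v 0‖ * ‖w 0‖ + ‖v 1‖ * ‖w 1‖ := by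
    refine (norm_add_le _ _).trans ?_
    simp
  refine h1.trans ?_
  rw [hnorm, hnorm, ← Real.sqrt_mul (by positivity)]
  apply Real.le_sqrt_of_sq_le
  nlinarith [sq_nonneg (‖v 0‖ * ‖w 1‖ - ‖v 1‖ * ‖w 0‖)]

theorem chord_triangle {u v w : Fin 2 → ℂ} (hu : u ≠ 0) (hv : v ≠ 0) (hw : w ≠ 0) :
    chord u w ≤ chord u v + chord v w := by
  have pu := hnorm_pos hu
  have pv := hnorm_pos hv
  have pw := hnorm_pos hw
  have key : ((hnorm v ^ 2 : ℝ) : ℂ) * (u 0 * w 1 - u 1 * w 0) =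
      (star (v 0) * w 0 + star (v 1) * w 1) * (u 0 * v 1 - u 1 * v 0) +
      (star (v 0) * u 0 + star (v 1) * u 1) * (v 0 * w 1 - v 1 * w 0) := by
    rw [hnorm_sq]
    push_cast
    rw [← Complex.conj_mul', ← Complex.conj_mul']
    simp only [← starRingEnd_apply]
    ring
  have h2 := congrArg norm key
  rw [norm_mul, Complex.norm_real, Real.norm_of_nonneg (by positivity)] at h2
  have h3 : hnorm v ^ 2 * ‖u 0 * w 1 - u 1 * w 0‖ ≤
      hnorm v * hnorm w * ‖u 0 * v 1 - u 1 * v 0‖ +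
      hnorm v * hnorm u * ‖v 0 * w 1 - v 1 * w 0‖ := by
    rw [h2]
    refine (norm_add_le _ _).trans ?_
    rw [norm_mul, norm_mul]
    gcongr
    · exact hnorm_inner_le v w
    · exact hnorm_inner_le v u
  unfold chord
  rw [div_add_div _ _ (by positivity) (by positivity), div_le_div_iff₀ (by positivity)
    (by positivity)]
  nlinarith [mul_le_mul_of_nonneg_left h3 (by positivity : 0 ≤ hnorm u * hnorm w)]

/-- The standard (chordal) metric of the projective line: the sine of the angle between two
complex lines. It is bi-Lipschitz equivalent to the Fubini–Study distance. -/
instance : MetricSpace P1 where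
  dist x y := chord x.rep y.rep
  dist_self x := chord_self _
  dist_comm x y := chord_comm _ _
  dist_triangle x y z := chord_triangle x.rep_nonzero y.rep_nonzero z.rep_nonzero
  eq_of_dist_eq_zero := by
    intro x y h
    have px := hnorm_pos x.rep_nonzero
    have py := hnorm_pos y.rep_nonzero
    have h0 : x.rep 0 * y.rep 1 - x.rep 1 * y.rep 0 = 0 := by
      have h' : ‖x.rep 0 * y.rep 1 - x.rep 1 * y.rep 0‖ / (hnorm x.rep * hnorm y.rep) = 0 := h
      rw [div_eq_zero_iff] at h'
      rcases h' with h' | h'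
      · simpa using h'
      · exact absurd h' (by positivity)
    rw [← x.mk_rep, ← y.mk_rep, Projectivization.mk_eq_mk_iff']
    have hy := y.rep_nonzero
    by_cases hy0 : y.rep 0 = 0
    · have hy1 : y.rep 1 ≠ 0 := by
        intro hy1
        apply hy
        ext i
        fin_cases i
        · exact hy0
        · exact hy1
      refine ⟨x.rep 1 / y.rep 1, ?_⟩
      have : x.rep 0 = 0 := by simpa [hy0, hy1] using h0
      ext i
      fin_cases i
      · simp [hy0, this]
      · simp [hy1]
    · refine ⟨x.rep 0 / y.rep 0, ?_⟩
      ext i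
      fin_cases i
      · simp [hy0]
      · simp only [Fin.mk_one, Pi.smul_apply, smul_eq_mul]
        field_simp
        linear_combination h0

theorem dist_mk_mk (v w : Fin 2 → ℂ) (hv : v ≠ 0) (hw : w ≠ 0) :
    dist (Projectivization.mk ℂ v hv) (Projectivization.mk ℂ w hw) = chord v w := by
  obtain ⟨a, ha⟩ := Projectivization.exists_smul_eq_mk_rep ℂ v hv
  obtain ⟨b, hb⟩ := Projectivization.exists_smul_eq_mk_rep ℂ w hw
  change chord (Projectivization.mk ℂ v hv).rep (Projectivization.mk ℂ w hw).rep = _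
  rw [← ha, ← hb, Units.smul_def, Units.smul_def, chord_smul _ _ a.ne_zero, chord_comm,
    chord_smul _ _ b.ne_zero, chord_comm]

/-- The Borel σ-algebra of the projective line. -/
instance : MeasurableSpace P1 := borel P1

instance : BorelSpace P1 := ⟨rfl⟩

/-- The operator norm `sup_{v ≠ 0} ‖A v‖ / ‖v‖` of a `2 × 2` matrix for the hermitian norm
of `ℂ²`. -/
def matNorm (A : Matrix (Fin 2) (Fin 2) ℂ) : ℝ := ‖Matrix.toEuclideanCLM (n := Fin 2) (𝕜 := ℂ) A‖

/-- The norm `‖g‖` of `g ∈ PSL₂(ℂ)`: the operator norm of any matrix representing `g`. -/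
def opNorm (g : G) : ℝ :=
  Quotient.liftOn' g (fun A : SL(2, ℂ) => matNorm A.1) (by
    intro A B h
    rw [QuotientGroup.leftRel_apply, Matrix.SpecialLinearGroup.mem_center_iff] at h
    obtain ⟨r, hr, hs⟩ := h
    have hB : B.1 = r • A.1 := by
      have h1 : B = A * (A⁻¹ * B) := by group
      rw [h1, Matrix.SpecialLinearGroup.coe_mul, ← hs]
      ext i j
      simp [mul_comm]
    have hr1 : ‖r‖ = 1 := by
      have h2 : ‖r‖ ^ 2 = 1 := by
        have := congrArg norm hr
        simpa using this
      nlinarith [norm_nonneg r]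
    change matNorm A.1 = matNorm B.1
    rw [hB, matNorm, matNorm, map_smul, norm_smul, hr1, one_mul])

/-- The convolution `μ * m` of a measure on `PSL₂(ℂ)` and a measure on the projective line, that is,
the push-forward `(f_μ)_* m` of `m` by the generalized correspondence associated with `μ`. -/
def push (μ : Measure G) (m : Measure P1) : Measure P1 :=
  (μ.prod m).map (fun p : G × P1 => p.1 • p.2)

/-- The convolution power `μ^{*n}`, the law of `gₙ ⋯ g₁` for independent `gᵢ` of law `μ`. -/
def convPow (μ : Measure G) : ℕ → Measure G
  | 0 => Measure.dirac 1
  | n + 1 => μ.mconv (convPow μ n)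

/-- `m` is stationary: `μ * m = m`. -/
def IsStationary (μ : Measure G) (m : Measure P1) : Prop := push μ m = m

/-- The support of `μ` preserves no non-empty finite subset of the projective line, and the
semigroup it generates is not relatively compact in `PSL₂(ℂ)`. -/
def NonElementary (μ : Measure G) : Prop :=
  (∀ F : Set P1, F.Finite → F.Nonempty → ¬ ∀ g ∈ μ.support, ∀ x ∈ F, g • x ∈ F) ∧
    ¬ IsCompact (closure (Subsemigroup.closure μ.support : Set G))

/-- The norm `‖φ‖_{C^β} = sup |φ| + sup_{x ≠ y} |φ x - φ y| / dist(x, y)^β` (for `φ` with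
`MemHolder β φ`). -/
def holderNorm (β : ℝ≥0) (φ : P1 → ℂ) : ℝ := (⨆ x, ‖φ x‖) + nnHolderNorm β φ

end RandomProducts

end

noncomputable section

namespace RandomProducts

open Filter Topology Matrix

/-! ### Norms of vectors and matrices -/

/-! The theorem follows from contraction in mean: there are `C` and `q < 1` with `∫ dist (g • x) (g
• y) ^ 2 ≤ C * q ^ n` over the law of the `n`-th random product, for all `x` and `y`. Given this
(`exists_integral_dist_sq_le`), limit points of the orbit of a Dirac mass are stationary, two
stationary measures agree on Lipschitz functions, and Jensen's inequality gives the rate `(√q) ^ (β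
* n)` for exponent `β`, so one `γ = √q` serves every `β`.

The exponential rate comes from a spectral gap, not from the moment. `SL₂(ℂ)` preserves Lebesgue
measure on `ℂ²`, hence acts unitarily on `L²(ℂ²)`. If non-negative unit vectors `f` were almost
invariant on average, the measures with density `f ^ 2`, pushed to the projective line, would
accumulate at a probability measure invariant under the support of `μ`. Non-elementarity forbids
this: an invariant measure with atoms yields a finite invariant set, and one without atoms bounds
the norms on the whole semigroup. This is `exists_spectral_gap`. Applied to the unit ball, whose
matrix coefficient at `g` is at least a constant times `‖g‖ ^ (-4)`, it gives `∫ ‖g h‖ ^ (-4) ≤ C *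
ρ ^ n`, uniformly in the right translate `h` (`exists_integral_opNorm_inv_le`).

To pass from norms to distances, represent `x ≠ y` by `v`, `w` with `v ∧ w = 1`, so that `dist (g •
x) (g • y) = 1 / (‖g v‖ ‖g w‖)`. If `h k` has columns `2 ^ (-k) v` and `2 ^ k w`, then for the `k`
that balances the two image columns, `‖g h k‖ ^ 2` is at most a constant times `‖g v‖ ‖g w‖`. When
`‖g‖ ^ 2 ≤ 4 ^ K` only `2 K + 1` values of `k` occur, and a union bound applies; the other `g` are
handled by Markov's inequality for `log ‖g‖`, whose mean grows at most linearly in `n`. Taking `K`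
exponentially large in `n`, but small against `ρ ^ (-n)`, makes both terms decay exponentially. -/

/-- The determinant of a pair of vectors of `ℂ²`. -/
def wedge (v w : Fin 2 → ℂ) : ℂ := v 0 * w 1 - v 1 * w 0

theorem chord_eq (v w : Fin 2 → ℂ) : chord v w = ‖wedge v w‖ / (hnorm v * hnorm w) := rfl

theorem hnorm_nonneg (v : Fin 2 → ℂ) : 0 ≤ hnorm v := Real.sqrt_nonneg _

theorem hnorm_zero : hnorm 0 = 0 := by simp [hnorm]

theorem hnorm_eq_norm (v : Fin 2 → ℂ) : hnorm v = ‖WithLp.toLp 2 v‖ := by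
  rw [EuclideanSpace.norm_eq, hnorm]; simp

theorem norm_le_hnorm (v : Fin 2 → ℂ) : ‖v‖ ≤ hnorm v := by
  rw [pi_norm_le_iff_of_nonneg (hnorm_nonneg v)]
  intro i
  apply Real.le_sqrt_of_sq_le
  fin_cases i <;> simp

theorem hnorm_le_two_norm (v : Fin 2 → ℂ) : hnorm v ≤ 2 * ‖v‖ := by
  rw [hnorm]
  apply Real.sqrt_le_iff.2 ⟨by positivity, ?_⟩
  have h0 := norm_le_pi_norm v 0
  have h1 := norm_le_pi_norm v 1
  nlinarith [norm_nonneg (v 0), norm_nonneg (v 1)]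

theorem hnorm_add_le (v w : Fin 2 → ℂ) : hnorm (v + w) ≤ hnorm v + hnorm w := by
  simp only [hnorm_eq_norm, WithLp.toLp_add]
  exact norm_add_le _ _

theorem continuous_hnorm : Continuous hnorm := by
  unfold hnorm; fun_prop

theorem norm_wedge_le (v w : Fin 2 → ℂ) : ‖wedge v w‖ ≤ hnorm v * hnorm w := by
  have h1 : ‖wedge v w‖ ≤ ‖v 0‖ * ‖w 1‖ + ‖v 1‖ * ‖w 0‖ := by
    refine (norm_sub_le _ _).trans ?_
    simp
  refine h1.trans ?_
  rw [hnorm, hnorm, ← Real.sqrt_mul (by positivity)]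
  apply Real.le_sqrt_of_sq_le
  nlinarith [sq_nonneg (‖v 0‖ * ‖w 0‖ - ‖v 1‖ * ‖w 1‖)]

theorem wedge_mulVec (A : SL(2, ℂ)) (v w : Fin 2 → ℂ) :
    wedge (A.1 *ᵥ v) (A.1 *ᵥ w) = wedge v w := by
  have h := A.2
  rw [Matrix.det_fin_two] at h
  simp only [wedge, Matrix.mulVec, dotProduct, Fin.sum_univ_two]
  linear_combination (v 0 * w 1 - v 1 * w 0) * h

theorem hnorm_mulVec_le (A : Matrix (Fin 2) (Fin 2) ℂ) (v : Fin 2 → ℂ) :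
    hnorm (A *ᵥ v) ≤ matNorm A * hnorm v := by
  rw [hnorm_eq_norm, hnorm_eq_norm]
  exact (Matrix.toEuclideanCLM (n := Fin 2) (𝕜 := ℂ) A).le_opNorm (WithLp.toLp 2 v)

theorem matNorm_nonneg (A : Matrix (Fin 2) (Fin 2) ℂ) : 0 ≤ matNorm A := norm_nonneg _

theorem matNorm_le {A : Matrix (Fin 2) (Fin 2) ℂ} {c : ℝ} (hc : 0 ≤ c)
    (h : ∀ v, hnorm (A *ᵥ v) ≤ c * hnorm v) : matNorm A ≤ c := by
  refine ContinuousLinearMap.opNorm_le_bound _ hc fun x => ?_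
  have := h x.ofLp
  rw [hnorm_eq_norm, hnorm_eq_norm] at this
  exact this

theorem continuous_matNorm : Continuous matNorm := by
  have : Continuous (Matrix.toEuclideanCLM (n := Fin 2) (𝕜 := ℂ)) :=
    LinearMap.continuous_of_finiteDimensional
      (Matrix.toEuclideanCLM (n := Fin 2) (𝕜 := ℂ)).toAlgEquiv.toLinearMap
  exact continuous_norm.comp this

theorem matNorm_mul_le (A B : Matrix (Fin 2) (Fin 2) ℂ) :
    matNorm (A * B) ≤ matNorm A * matNorm B := by
  rw [matNorm, map_mul]
  exact norm_mul_le _ _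

theorem one_le_matNorm (A : SL(2, ℂ)) : 1 ≤ matNorm A.1 := by
  have h := norm_wedge_le (A.1 *ᵥ ![1, 0]) (A.1 *ᵥ ![0, 1])
  rw [wedge_mulVec] at h
  have h0 := hnorm_mulVec_le A.1 ![1, 0]
  have h1 := hnorm_mulVec_le A.1 ![0, 1]
  simp [wedge, hnorm] at h h0 h1
  have h2 := matNorm_nonneg A.1
  by_contra hlt
  push Not at hlt
  have h3 := h.trans (mul_le_mul h0 h1 (Real.sqrt_nonneg _) h2)
  nlinarith

/-- This is `‖A⁻¹‖ ≤ ‖A‖` in determinant one: for the orthogonal vector `w` of the same length, `‖v‖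
^ 2 = |v ∧ w| = |A v ∧ A w| ≤ ‖A v‖ ‖A‖ ‖v‖`. -/
theorem hnorm_le_mulVec (A : SL(2, ℂ)) (v : Fin 2 → ℂ) :
    hnorm v ≤ matNorm A.1 * hnorm (A.1 *ᵥ v) := by
  rcases eq_or_ne v 0 with rfl | hv
  · simp [hnorm_zero]
  have hp := hnorm_pos hv
  let w : Fin 2 → ℂ := ![-star (v 1), star (v 0)]
  have hw : hnorm w = hnorm v := by simp [hnorm, w, add_comm]
  have hvw : ‖wedge v w‖ = hnorm v ^ 2 := by
    have : wedge v w = ((hnorm v ^ 2 : ℝ) : ℂ) := by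
      rw [hnorm_sq]
      push_cast
      rw [← Complex.conj_mul', ← Complex.conj_mul']
      simp only [wedge, w, ← starRingEnd_apply]
      simp
      ring
    rw [this, Complex.norm_real, Real.norm_of_nonneg (by positivity)]
  have h := norm_wedge_le (A.1 *ᵥ v) (A.1 *ᵥ w)
  rw [wedge_mulVec, hvw] at h
  have h1 := hnorm_mulVec_le A.1 w
  rw [hw] at h1
  have h2 := h.trans (mul_le_mul_of_nonneg_left h1 (hnorm_nonneg _))
  nlinarith

theorem matNorm_le_add (A : Matrix (Fin 2) (Fin 2) ℂ) :
    matNorm A ≤ hnorm (A *ᵥ ![1, 0]) + hnorm (A *ᵥ ![0, 1]) := by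
  have hp := hnorm_nonneg (A *ᵥ ![1, 0])
  have hq := hnorm_nonneg (A *ᵥ ![0, 1])
  refine matNorm_le (by positivity) fun v => ?_
  have hv : v = v 0 • ![1, 0] + v 1 • ![0, 1] := by
    ext i; fin_cases i <;> simp
  have h0 := (norm_le_pi_norm v 0).trans (norm_le_hnorm v)
  have h1 := (norm_le_pi_norm v 1).trans (norm_le_hnorm v)
  calc hnorm (A *ᵥ v) = hnorm (v 0 • (A *ᵥ ![1, 0]) + v 1 • (A *ᵥ ![0, 1])) := by
        conv_lhs => rw [hv]
        rw [Matrix.mulVec_add, Matrix.mulVec_smul, Matrix.mulVec_smul]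
    _ ≤ ‖v 0‖ * hnorm (A *ᵥ ![1, 0]) + ‖v 1‖ * hnorm (A *ᵥ ![0, 1]) := by
        refine (hnorm_add_le _ _).trans ?_
        rw [hnorm_smul, hnorm_smul]
    _ ≤ _ := by nlinarith

theorem mulVec_ne_zero (A : SL(2, ℂ)) {v : Fin 2 → ℂ} (hv : v ≠ 0) : A.1 *ᵥ v ≠ 0 := by
  intro h
  have h1 := hnorm_le_mulVec A v
  rw [h] at h1
  have h2 := hnorm_pos hv
  rw [hnorm_zero, mul_zero] at h1
  linarith

/-! ### The action on the projective line -/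

theorem mk_smul_mk (A : SL(2, ℂ)) {v : Fin 2 → ℂ} (hv : v ≠ 0) :
    (QuotientGroup.mk A : G) • (Projectivization.mk ℂ v hv : P1) =
      Projectivization.mk ℂ (A.1 *ᵥ v) (mulVec_ne_zero A hv) := rfl

theorem opNorm_mk (A : SL(2, ℂ)) : opNorm (QuotientGroup.mk A : G) = matNorm A.1 := rfl

theorem one_le_opNorm (g : G) : 1 ≤ opNorm g := by
  induction g using QuotientGroup.induction_on with
  | H A => exact one_le_matNorm A

theorem opNorm_pos (g : G) : 0 < opNorm g := one_pos.trans_le (one_le_opNorm g)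

theorem opNorm_mul_le (g h : G) : opNorm (g * h) ≤ opNorm g * opNorm h := by
  induction g using QuotientGroup.induction_on with
  | H A =>
    induction h using QuotientGroup.induction_on with
    | H B => exact matNorm_mul_le A.1 B.1

theorem continuous_opNorm : Continuous opNorm := by
  refine continuous_quot_lift _ ?_
  exact continuous_matNorm.comp continuous_subtype_val

theorem dist_le_one (x y : P1) : dist x y ≤ 1 := by
  induction x using Projectivization.ind with | h v hv =>
  induction y using Projectivization.ind with | h w hw =>
  rw [dist_mk_mk, chord_eq]
  exact div_le_one_of_le₀ (norm_wedge_le v w) (mul_nonneg (hnorm_nonneg v) (hnorm_nonneg w))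

theorem dist_mk_smul (A : SL(2, ℂ)) {v w : Fin 2 → ℂ} (hv : v ≠ 0) (hw : w ≠ 0) :
    dist ((QuotientGroup.mk A : G) • (Projectivization.mk ℂ v hv : P1))
      ((QuotientGroup.mk A : G) • (Projectivization.mk ℂ w hw : P1)) =
      ‖wedge v w‖ / (hnorm (A.1 *ᵥ v) * hnorm (A.1 *ᵥ w)) := by
  rw [mk_smul_mk, mk_smul_mk, dist_mk_mk, chord_eq, wedge_mulVec]

theorem dist_smul_le (g : G) (x y : P1) : dist (g • x) (g • y) ≤ opNorm g ^ 2 * dist x y := by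
  induction g using QuotientGroup.induction_on with | H A =>
  induction x using Projectivization.ind with | h v hv =>
  induction y using Projectivization.ind with | h w hw =>
  rw [dist_mk_smul, dist_mk_mk, chord_eq, opNorm_mk]
  have h1 := hnorm_le_mulVec A v
  have h2 := hnorm_le_mulVec A w
  have pv := hnorm_pos hv
  have pw := hnorm_pos hw
  have pAv := hnorm_pos (mulVec_ne_zero A hv)
  have pAw := hnorm_pos (mulVec_ne_zero A hw)
  rw [← mul_div_assoc, div_le_div_iff₀ (by positivity) (by positivity)]
  calc ‖wedge v w‖ * (hnorm v * hnorm w)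
      ≤ ‖wedge v w‖ * ((matNorm A.1 * hnorm (A.1 *ᵥ v)) * (matNorm A.1 * hnorm (A.1 *ᵥ w))) := by
        gcongr
        exact (hnorm_nonneg v).trans h1
    _ = _ := by ring

theorem continuous_chord_right {X : Type*} [TopologicalSpace X] {f : X → Fin 2 → ℂ}
    (hf : Continuous f) (hne : ∀ x, f x ≠ 0) {w : Fin 2 → ℂ} (hw : w ≠ 0) :
    Continuous fun x => chord (f x) w := by
  unfold chord
  refine Continuous.div ?_ ?_ fun x => ?_
  · fun_prop
  · exact (continuous_hnorm.comp hf).mul continuous_const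
  · exact (mul_pos (hnorm_pos (hne x)) (hnorm_pos hw)).ne'

theorem continuous_mk {X : Type*} [TopologicalSpace X] {f : X → Fin 2 → ℂ}
    (hf : Continuous f) (hne : ∀ x, f x ≠ 0) :
    Continuous fun x => (Projectivization.mk ℂ (f x) (hne x) : P1) := by
  rw [continuous_iff_continuousAt]
  intro x
  rw [ContinuousAt, tendsto_iff_dist_tendsto_zero]
  simp only [dist_mk_mk]
  have := (continuous_chord_right hf hne (hne x)).tendsto x
  rwa [chord_self] at this

instance : ContinuousSMul G P1 where
  continuous_smul := by
    -- Continuity can be tested on `SL₂(ℂ) × P1`, because the product of an open quotient map with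
    -- the identity is again a quotient map.
    have hq : IsOpenQuotientMap (Prod.map (QuotientGroup.mk : SL(2, ℂ) → G) (id : P1 → P1)) :=
      (QuotientGroup.isOpenQuotientMap_mk).prodMap IsOpenQuotientMap.id
    rw [hq.isQuotientMap.continuous_iff, continuous_iff_continuousAt]
    rintro ⟨A, x⟩
    rw [ContinuousAt, tendsto_iff_dist_tendsto_zero]
    have h1 : Continuous fun p : SL(2, ℂ) × P1 =>
        opNorm (QuotientGroup.mk p.1 : G) ^ 2 * dist p.2 x +
          dist ((QuotientGroup.mk p.1 : G) • x) ((QuotientGroup.mk A : G) • x) := by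
      have h2 : Continuous fun p : SL(2, ℂ) × P1 => opNorm (QuotientGroup.mk p.1 : G) :=
        continuous_opNorm.comp (QuotientGroup.continuous_mk.comp continuous_fst)
      have h3 : Continuous fun p : SL(2, ℂ) × P1 => (QuotientGroup.mk p.1 : G) • x := by
        induction x using Projectivization.ind with | h v hv =>
        simp only [mk_smul_mk]
        refine continuous_mk (f := fun p : SL(2, ℂ) × P1 => p.1.1 *ᵥ v) ?_ _
        exact (continuous_subtype_val.comp continuous_fst).matrix_mulVec continuous_const
      fun_prop
    have h4 := h1.tendsto (A, x)
    simp only [dist_self, mul_zero, add_zero] at h4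
    refine squeeze_zero (fun _ => dist_nonneg) (fun p => ?_) h4
    refine (dist_triangle _ ((QuotientGroup.mk p.1 : G) • x) _).trans ?_
    exact add_le_add_left (dist_smul_le _ _ _) _

end RandomProducts

end

noncomputable section

namespace RandomProducts

open Filter Topology Matrix

/-! ### Topology and measurability of `PSL₂(ℂ)` and of the projective line -/

theorem isClosedEmbedding_val :
    IsClosedEmbedding (Subtype.val : SL(2, ℂ) → Matrix (Fin 2) (Fin 2) ℂ) := by
  refine IsClosed.isClosedEmbedding_subtypeVal ?_
  exact isClosed_eq (Continuous.matrix_det continuous_id) continuous_const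

instance : PolishSpace (Matrix (Fin 2) (Fin 2) ℂ) :=
  inferInstanceAs (PolishSpace (Fin 2 → Fin 2 → ℂ))

instance : PolishSpace SL(2, ℂ) := isClosedEmbedding_val.polishSpace

instance : MeasurableSpace SL(2, ℂ) := borel _

instance : BorelSpace SL(2, ℂ) := ⟨rfl⟩

instance : IsClosed ((Subgroup.center SL(2, ℂ) : Subgroup SL(2, ℂ)) : Set SL(2, ℂ)) := by
  have : ((Subgroup.center SL(2, ℂ) : Subgroup SL(2, ℂ)) : Set SL(2, ℂ)) =
      ⋂ h : SL(2, ℂ), {g | h * g = g * h} := by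
    ext g
    simp [Subgroup.mem_center_iff]
  rw [this]
  exact isClosed_iInter fun h => isClosed_eq (by fun_prop) (by fun_prop)

instance : T3Space G := inferInstanceAs (T3Space (SL(2, ℂ) ⧸ Subgroup.center SL(2, ℂ)))

instance : SecondCountableTopology G :=
  inferInstanceAs (SecondCountableTopology (SL(2, ℂ) ⧸ Subgroup.center SL(2, ℂ)))

/-- A Borel surjection from a Polish space onto a second countable Hausdorff space is a quotient map
of Borel structures, so measurability on `PSL₂(ℂ)` can be checked upstairs. -/
theorem measurable_comp_mk {β : Type*} [MeasurableSpace β] {f : G → β} :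
    Measurable (f ∘ (QuotientGroup.mk : SL(2, ℂ) → G)) ↔ Measurable f :=
  QuotientGroup.continuous_mk.measurable.measurable_comp_iff_of_surjective
    QuotientGroup.mk_surjective

theorem mk_eq_mk_iff {A B : SL(2, ℂ)} :
    (QuotientGroup.mk A : G) = QuotientGroup.mk B ↔ B = A ∨ B = -A := by
  rw [QuotientGroup.eq, Matrix.SpecialLinearGroup.mem_center_iff]
  constructor
  · rintro ⟨r, hr, hs⟩
    have hB : B.1 = r • A.1 := by
      have h1 : B = A * (A⁻¹ * B) := by group
      rw [h1, Matrix.SpecialLinearGroup.coe_mul, ← hs]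
      ext i j
      simp [mul_comm]
    rw [Fintype.card_fin, sq_eq_one_iff] at hr
    rcases hr with rfl | rfl
    · left; ext i j; simp [hB]
    · right; ext i j; simp [hB]
  · rintro (rfl | rfl)
    · exact ⟨1, by simp, by simp⟩
    · refine ⟨-1, by simp, ?_⟩
      have : A⁻¹ * -A = -1 := by simp
      rw [this]
      ext i j
      fin_cases i <;> fin_cases j <;> simp [Matrix.scalar_apply]

/-- A half of `ℂ \ {0}` containing exactly one of `z` and `-z` for all `z ≠ 0`. -/
def IsPositive (z : ℂ) : Prop := 0 < z.re ∨ (z.re = 0 ∧ 0 < z.im)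

theorem isPositive_neg {z : ℂ} (hz : z ≠ 0) : IsPositive (-z) ↔ ¬ IsPositive z := by
  have : ¬ (z.re = 0 ∧ z.im = 0) := fun h => hz (Complex.ext h.1 h.2)
  simp only [IsPositive, Complex.neg_re, Complex.neg_im]
  grind

/-- The first non-zero entry of the first row. -/
def leadingEntry (A : SL(2, ℂ)) : ℂ := open Classical in if A.1 0 0 = 0 then A.1 0 1 else A.1 0 0

theorem leadingEntry_ne_zero (A : SL(2, ℂ)) : leadingEntry A ≠ 0 := by
  have h := A.2
  rw [Matrix.det_fin_two] at h
  unfold leadingEntry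
  split_ifs with h0
  · intro h1
    simp [h0, h1] at h
  · exact h0

theorem leadingEntry_neg (A : SL(2, ℂ)) : leadingEntry (-A) = -leadingEntry A := by
  simp only [leadingEntry, Matrix.SpecialLinearGroup.coe_neg, Matrix.neg_apply, neg_eq_zero]
  split_ifs <;> rfl

/-- The representative of the class of `A` whose leading entry is positive. -/
def signNormalize (A : SL(2, ℂ)) : SL(2, ℂ) := open Classical in
  if IsPositive (leadingEntry A) then A else -A

theorem signNormalize_neg (A : SL(2, ℂ)) : signNormalize (-A) = signNormalize A := by
  unfold signNormalize
  rw [leadingEntry_neg, isPositive_neg (leadingEntry_ne_zero A)]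
  by_cases h : IsPositive (leadingEntry A) <;> simp [h]

theorem mk_signNormalize (A : SL(2, ℂ)) :
    (QuotientGroup.mk (signNormalize A) : G) = QuotientGroup.mk A := by
  rw [mk_eq_mk_iff]
  unfold signNormalize
  split_ifs <;> simp

/-- A Borel section of `SL₂(ℂ) → PSL₂(ℂ)`. -/
def lift (g : G) : SL(2, ℂ) :=
  Quotient.liftOn' g signNormalize (by
    intro A B h
    have h1 : (QuotientGroup.mk A : G) = QuotientGroup.mk B := Quotient.sound' h
    rcases mk_eq_mk_iff.1 h1 with rfl | rfl
    · rfl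
    · exact (signNormalize_neg A).symm)

theorem mk_lift (g : G) : (QuotientGroup.mk (lift g) : G) = g := by
  induction g using QuotientGroup.induction_on with | H A => exact mk_signNormalize A

theorem opNorm_eq_lift (g : G) : opNorm g = matNorm (lift g).1 := by
  conv_lhs => rw [← mk_lift g, opNorm_mk]

theorem lift_mul (g h : G) : lift (g * h) = lift g * lift h ∨ lift (g * h) = -(lift g * lift h) := by
  rw [← mk_eq_mk_iff, mk_lift, QuotientGroup.mk_mul, mk_lift, mk_lift]

theorem lift_one : lift 1 = 1 ∨ lift 1 = -1 := by
  rw [← mk_eq_mk_iff, mk_lift]; rfl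

theorem measurable_entry (i j : Fin 2) : Measurable fun A : SL(2, ℂ) => A.1 i j := by
  have : Continuous fun A : SL(2, ℂ) => A.1 i j :=
    (continuous_apply_apply i j).comp continuous_subtype_val
  exact this.measurable

theorem measurable_signNormalize : Measurable signNormalize := by
  have h1 : Measurable leadingEntry := by
    unfold leadingEntry
    exact Measurable.ite (measurable_entry 0 0 (measurableSet_singleton 0)) (measurable_entry 0 1)
      (measurable_entry 0 0)
  have h2 : MeasurableSet {z : ℂ | IsPositive z} := by
    refine (measurableSet_lt measurable_const Complex.measurable_re).union
      ((measurableSet_eq_fun Complex.measurable_re measurable_const).inter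
        (measurableSet_lt measurable_const Complex.measurable_im))
  have h3 : Continuous fun A : SL(2, ℂ) => -A := by
    refine Continuous.subtype_mk (f := fun A : SL(2, ℂ) => -A.1) ?_ _
    exact continuous_subtype_val.neg
  unfold signNormalize
  exact Measurable.ite (h1 h2) measurable_id h3.measurable

theorem measurable_lift : Measurable lift := by
  rw [← measurable_comp_mk]
  exact measurable_signNormalize

theorem measurable_lift_mulVec :
    Measurable fun p : G × (Fin 2 → ℂ) => (lift p.1).1 *ᵥ p.2 := by
  rw [measurable_pi_iff]
  intro i
  simp only [Matrix.mulVec, dotProduct]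
  refine Finset.measurable_fun_sum _ fun j _ => ?_
  exact ((measurable_entry i j).comp (measurable_lift.comp measurable_fst)).mul
    ((measurable_pi_apply j).comp measurable_snd)

/-- Properness of the norm: a bound on norms over the semigroup becomes relative compactness, which
non-elementarity excludes. -/
theorem isCompact_opNorm_le (c : ℝ) : IsCompact {g : G | opNorm g ≤ c} := by
  have hK : IsCompact (Set.pi Set.univ fun _ : Fin 2 => Set.pi Set.univ fun _ : Fin 2 =>
      Metric.closedBall (0 : ℂ) c) :=
    isCompact_univ_pi fun _ => isCompact_univ_pi fun _ => isCompact_closedBall 0 c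
  have h1 := isClosedEmbedding_val.isCompact_preimage (K := Set.pi Set.univ fun _ : Fin 2 =>
    Set.pi Set.univ fun _ : Fin 2 => Metric.closedBall (0 : ℂ) c) hK
  have h2 : IsCompact {A : SL(2, ℂ) | matNorm A.1 ≤ c} := by
    refine h1.of_isClosed_subset (isClosed_le (continuous_matNorm.comp continuous_subtype_val)
      continuous_const) ?_
    intro A hA i _ j _
    rw [mem_closedBall_zero_iff]
    have h3 := hnorm_mulVec_le A.1 (Pi.single j 1)
    have h4 : hnorm (Pi.single j (1 : ℂ)) = 1 := by
      fin_cases j <;> simp [hnorm]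
    have h5 := (norm_le_pi_norm (A.1 *ᵥ Pi.single j 1) i).trans (norm_le_hnorm _)
    rw [h4, mul_one] at h3
    simp only [Matrix.mulVec_single_one, Matrix.col_apply] at h5
    rw [Matrix.mulVec_single_one] at h3
    exact h5.trans (h3.trans hA)
  have h6 : {g : G | opNorm g ≤ c} = QuotientGroup.mk '' {A : SL(2, ℂ) | matNorm A.1 ≤ c} := by
    ext g
    constructor
    · intro hg
      refine ⟨lift g, ?_, mk_lift g⟩
      rw [Set.mem_ofPred_eq, opNorm_eq_lift] at hg
      exact hg
    · rintro ⟨A, hA, rfl⟩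
      exact hA
  rw [h6]
  exact h2.image QuotientGroup.continuous_mk

instance : CompactSpace P1 := by
  let S : Set (Fin 2 → ℂ) := {v | hnorm v = 1}
  have hS : IsCompact S := by
    refine (isCompact_closedBall (0 : Fin 2 → ℂ) 1).of_isClosed_subset
      (isClosed_eq continuous_hnorm continuous_const) ?_
    intro v hv
    rw [mem_closedBall_zero_iff, ← hv]
    exact norm_le_hnorm v
  have hne : ∀ v : S, v.1 ≠ 0 := by
    rintro ⟨v, hv⟩ rfl
    simp [S, hnorm_zero] at hv
  have hc : Continuous fun v : S => (Projectivization.mk ℂ v.1 (hne v) : P1) :=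
    continuous_mk continuous_subtype_val hne
  have : CompactSpace S := isCompact_iff_compactSpace.1 hS
  refine ⟨?_⟩
  convert! isCompact_range hc
  symm
  rw [Set.eq_univ_iff_forall]
  intro x
  induction x using Projectivization.ind with | h v hv =>
  have hp := hnorm_pos hv
  refine ⟨⟨((hnorm v)⁻¹ : ℂ) • v, ?_⟩, ?_⟩
  · change hnorm _ = 1
    rw [hnorm_smul, norm_inv, Complex.norm_real, Real.norm_of_nonneg hp.le, inv_mul_cancel₀ hp.ne']
  · rw [Projectivization.mk_eq_mk_iff']
    exact ⟨_, rfl⟩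

theorem measurable_opNorm : Measurable opNorm := continuous_opNorm.measurable

theorem measurable_smul_prod : Measurable fun p : G × P1 => p.1 • p.2 :=
  continuous_smul.measurable

/-- The line spanned by a vector, with a default value at `0`. -/
def toP1 (v : Fin 2 → ℂ) : P1 := open Classical in
  if h : v = 0 then Projectivization.mk ℂ ![1, 0] (by simp) else Projectivization.mk ℂ v h

theorem toP1_of_ne {v : Fin 2 → ℂ} (h : v ≠ 0) : toP1 v = Projectivization.mk ℂ v h := by
  simp [toP1, h]

theorem measurable_toP1 : Measurable toP1 := by
  classical
  refine Measurable.dite (s := {v : Fin 2 → ℂ | v = 0}) measurable_const ?_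
    (measurableSet_singleton 0)
  exact (continuous_mk continuous_subtype_val fun x : {v : Fin 2 → ℂ | ¬ v = 0} => x.2).measurable

theorem smul_toP1 (g : G) {v : Fin 2 → ℂ} (hv : v ≠ 0) :
    g • toP1 v = toP1 ((lift g).1 *ᵥ v) := by
  rw [toP1_of_ne hv, toP1_of_ne (mulVec_ne_zero _ hv), ← mk_smul_mk, mk_lift]

end RandomProducts

end

noncomputable section

namespace RandomProducts

open Filter Topology Matrix

/-! ### Invariant measures on the projective line -/

/-- By Cramer's rule every `u` is a combination of `v` and `w` with denominator `v ∧ w`. If `A` is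
small on both and they are far from parallel, then `A` is smaller than its own norm everywhere. -/
theorem norm_wedge_le_of_contracted (A : SL(2, ℂ)) {τ : ℝ} (hτ : 0 ≤ τ) {v w : Fin 2 → ℂ}
    (hv : hnorm (A.1 *ᵥ v) ≤ τ * matNorm A.1 * hnorm v)
    (hw : hnorm (A.1 *ᵥ w) ≤ τ * matNorm A.1 * hnorm w) :
    ‖wedge v w‖ ≤ 2 * τ * (hnorm v * hnorm w) := by
  have pv := hnorm_nonneg v
  have pw := hnorm_nonneg w
  have pA := matNorm_nonneg A.1
  rcases (norm_nonneg (wedge v w)).eq_or_lt with h0 | h0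
  · rw [← h0]; positivity
  have key : ∀ u, ‖wedge v w‖ * hnorm (A.1 *ᵥ u) ≤
      2 * τ * (hnorm v * hnorm w) * matNorm A.1 * hnorm u := by
    intro u
    have e : wedge v w • u = wedge u w • v + wedge v u • w := by
      ext i
      fin_cases i <;> simp [wedge] <;> ring
    calc ‖wedge v w‖ * hnorm (A.1 *ᵥ u)
        = hnorm (wedge u w • (A.1 *ᵥ v) + wedge v u • (A.1 *ᵥ w)) := by
          rw [← hnorm_smul, ← Matrix.mulVec_smul, e, Matrix.mulVec_add, Matrix.mulVec_smul,
            Matrix.mulVec_smul]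
      _ ≤ ‖wedge u w‖ * hnorm (A.1 *ᵥ v) + ‖wedge v u‖ * hnorm (A.1 *ᵥ w) := by
          refine (hnorm_add_le _ _).trans ?_
          rw [hnorm_smul, hnorm_smul]
      _ ≤ (hnorm u * hnorm w) * (τ * matNorm A.1 * hnorm v) +
          (hnorm v * hnorm u) * (τ * matNorm A.1 * hnorm w) := by
          have := hnorm_nonneg u
          gcongr
          · exact hnorm_nonneg _
          · exact norm_wedge_le u w
          · exact hnorm_nonneg _
          · exact norm_wedge_le v u
      _ = _ := by ring
  have h1 : matNorm A.1 ≤ 2 * τ * (hnorm v * hnorm w) * matNorm A.1 / ‖wedge v w‖ := by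
    refine matNorm_le (by positivity) fun u => ?_
    rw [div_mul_eq_mul_div, le_div_iff₀ h0, mul_comm]
    exact key u
  rw [le_div_iff₀ h0] at h1
  have := one_le_matNorm A
  nlinarith

/-- North-south dynamics: a `g` of large norm sends the complement of a small ball into a small
ball. The directions contracted below `τ ‖g‖` lie close together, and two other directions have
images at distance at most `1 / (τ ‖g‖) ^ 2`. -/
theorem exists_dist_le_or_dist_smul_le (g : G) {τ : ℝ} (hτ : 0 < τ) :
    ∃ x y : P1, ∀ z, dist z x ≤ 2 * τ ∨ dist (g • z) y ≤ 1 / (τ ^ 2 * opNorm g ^ 2) := by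
  induction g using QuotientGroup.induction_on with | H A =>
  have pA : 0 < matNorm A.1 := one_pos.trans_le (one_le_matNorm A)
  rw [opNorm_mk]
  let bad : P1 → Prop := fun x => ∃ v, ∃ hv : v ≠ 0, x = Projectivization.mk ℂ v hv ∧
    hnorm (A.1 *ᵥ v) ≤ τ * matNorm A.1 * hnorm v
  have h1 : ∀ x y, bad x → bad y → dist x y ≤ 2 * τ := by
    rintro _ _ ⟨v, hv, rfl, h1⟩ ⟨w, hw, rfl, h2⟩
    have pv := hnorm_pos hv
    have pw := hnorm_pos hw
    rw [dist_mk_mk, chord_eq, div_le_iff₀ (by positivity)]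
    exact norm_wedge_le_of_contracted A hτ.le h1 h2
  have h2 : ∀ x y, ¬ bad x → ¬ bad y → dist ((QuotientGroup.mk A : G) • x)
      ((QuotientGroup.mk A : G) • y) ≤ 1 / (τ ^ 2 * matNorm A.1 ^ 2) := by
    intro x y hx hy
    induction x using Projectivization.ind with | h v hv =>
    induction y using Projectivization.ind with | h w hw =>
    have h3 : τ * matNorm A.1 * hnorm v ≤ hnorm (A.1 *ᵥ v) := by
      by_contra h
      exact hx ⟨v, hv, rfl, (not_le.1 h).le⟩
    have h4 : τ * matNorm A.1 * hnorm w ≤ hnorm (A.1 *ᵥ w) := by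
      by_contra h
      exact hy ⟨w, hw, rfl, (not_le.1 h).le⟩
    have pv := hnorm_pos hv
    have pw := hnorm_pos hw
    have pAv := hnorm_pos (mulVec_ne_zero A hv)
    have pAw := hnorm_pos (mulVec_ne_zero A hw)
    rw [dist_mk_smul, div_le_div_iff₀ (by positivity) (by positivity), one_mul]
    calc ‖wedge v w‖ * (τ ^ 2 * matNorm A.1 ^ 2)
        ≤ (hnorm v * hnorm w) * (τ ^ 2 * matNorm A.1 ^ 2) := by
          gcongr; exact norm_wedge_le v w
      _ = (τ * matNorm A.1 * hnorm v) * (τ * matNorm A.1 * hnorm w) := by ring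
      _ ≤ _ := by gcongr
  obtain ⟨p⟩ : Nonempty P1 := ⟨toP1 0⟩
  by_cases hb : ∃ x, bad x
  · obtain ⟨x, hx⟩ := hb
    by_cases hg : ∃ y, ¬ bad y
    · obtain ⟨y, hy⟩ := hg
      refine ⟨x, (QuotientGroup.mk A : G) • y, fun z => ?_⟩
      by_cases hz : bad z
      · exact Or.inl (h1 z x hz hx)
      · exact Or.inr (h2 z y hz hy)
    · push Not at hg
      exact ⟨x, p, fun z => Or.inl (h1 z x (hg z) hx)⟩
  · push Not at hb
    exact ⟨p, (QuotientGroup.mk A : G) • p, fun z => Or.inr (h2 z p (hb z) (hb p))⟩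

/-- A finite measure without atoms on a compact metric space gives uniformly small mass to small
balls. -/
theorem exists_forall_measure_closedBall_lt {X : Type*} [MetricSpace X] [CompactSpace X]
    [MeasurableSpace X] [BorelSpace X] (σ : Measure X) [IsFiniteMeasure σ] (h : ∀ x, σ {x} = 0)
    {c : ENNReal} (hc : 0 < c) : ∃ r > 0, ∀ x, σ (Metric.closedBall x r) < c := by
  by_contra! hcon
  have hpos : ∀ j : ℕ, (0 : ℝ) < 1 / (j + 1) := fun j => Nat.one_div_pos_of_nat
  choose x hx using fun j : ℕ => hcon (1 / (j + 1)) (hpos j)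
  obtain ⟨y, -, φ, hφ, hlim⟩ := isCompact_univ.tendsto_subseq (x := x) fun _ => Set.mem_univ _
  have hball : ∀ ε > 0, c ≤ σ (Metric.closedBall y ε) := by
    intro ε hε
    have h1 : ∀ᶠ j in atTop, dist (x (φ j)) y < ε / 2 :=
      (tendsto_iff_dist_tendsto_zero.1 hlim).eventually_lt_const (half_pos hε)
    have h2 : ∀ᶠ j in atTop, 1 / ((φ j : ℝ) + 1) < ε / 2 :=
      (tendsto_one_div_add_atTop_nhds_zero_nat.comp hφ.tendsto_atTop).eventually_lt_const
        (half_pos hε)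
    obtain ⟨j, h1, h2⟩ := (h1.and h2).exists
    refine (hx (φ j)).trans (measure_mono (Metric.closedBall_subset_closedBall' ?_))
    linarith
  have hlim2 : Tendsto (fun j : ℕ => σ (Metric.closedBall y (1 / ((j : ℝ) + 1)))) atTop
      (𝓝 (σ (⋂ j : ℕ, Metric.closedBall y (1 / ((j : ℝ) + 1))))) := by
    refine tendsto_measure_iInter_atTop
      (fun j => Metric.isClosed_closedBall.measurableSet.nullMeasurableSet) ?_
      ⟨0, measure_ne_top _ _⟩
    intro i j hij
    exact Metric.closedBall_subset_closedBall (Nat.one_div_le_one_div hij)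
  have hinter : (⋂ j : ℕ, Metric.closedBall y (1 / ((j : ℝ) + 1))) = {y} := by
    ext z
    simp only [Set.mem_iInter, Metric.mem_closedBall, Set.mem_singleton_iff]
    constructor
    · intro hz
      exact dist_le_zero.1 (ge_of_tendsto' tendsto_one_div_add_atTop_nhds_zero_nat hz)
    · rintro rfl j
      rw [dist_self]
      exact (hpos j).le
  rw [hinter, h y] at hlim2
  exact absurd (ge_of_tendsto' hlim2 fun j => hball _ (hpos j)) (not_le.2 hc)

/-- If `‖g‖` is large, a small ball and the preimage of a small ball cover the line. When `σ` is
`g`-invariant without atoms, both have mass below one half. -/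
theorem exists_opNorm_le_of_map_eq (σ : Measure P1) [IsProbabilityMeasure σ]
    (h : ∀ x, σ {x} = 0) :
    ∃ C : ℝ, ∀ g : G, σ.map (fun x => g • x) = σ → opNorm g ≤ C := by
  obtain ⟨r, hr, hball⟩ := exists_forall_measure_closedBall_lt σ h (c := 1 / 2) (by simp)
  -- With `τ = r / 2`, this makes `τ ‖g‖ > 1 / r + 1`; the `+ 1` ensures that the square exceeds `1
  -- / r` whatever the size of `r`.
  refine ⟨1 / (r / 2) * (1 / r + 1), fun g hg => ?_⟩
  by_contra! hlt
  obtain ⟨x, y, hxy⟩ := exists_dist_le_or_dist_smul_le g (half_pos hr)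
  have pg := opNorm_pos g
  have hsmall : 1 / ((r / 2) ^ 2 * opNorm g ^ 2) ≤ r := by
    have h2 : 1 / r + 1 < (r / 2) * opNorm g := by
      rw [one_div_mul_eq_div, div_lt_iff₀ (by positivity)] at hlt
      linarith
    have h3 : 1 / r ≤ ((r / 2) * opNorm g) ^ 2 := by
      have : 0 < 1 / r := by positivity
      nlinarith
    rw [← mul_pow]
    rw [div_le_iff₀ (by positivity)] at h3 ⊢
    linarith
  have hcov : (Set.univ : Set P1) ⊆ Metric.closedBall x r ∪
      (fun x => g • x) ⁻¹' Metric.closedBall y r := by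
    intro z _
    rcases hxy z with h1 | h1
    · left
      rw [Metric.mem_closedBall]
      linarith
    · right
      exact h1.trans hsmall
  have hm : Measurable fun x : P1 => g • x := (continuous_const_smul g).measurable
  have h2 : σ ((fun x => g • x) ⁻¹' Metric.closedBall y r) < 1 / 2 := by
    rw [← Measure.map_apply hm Metric.isClosed_closedBall.measurableSet, hg]
    exact hball y
  have h3 := (measure_mono hcov).trans (measure_union_le (μ := σ) _ _)
  rw [measure_univ] at h3
  have h4 := h3.trans_lt (ENNReal.add_lt_add (hball x) h2)
  rw [ENNReal.add_halves] at h4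
  exact lt_irrefl _ h4

theorem map_singleton_smul {σ : Measure P1} {g : G} (hg : σ.map (fun x => g • x) = σ) (x : P1) :
    σ {g • x} = σ {x} := by
  have hm : Measurable fun x : P1 => g • x := (continuous_const_smul g).measurable
  conv_lhs => rw [← hg]
  rw [Measure.map_apply hm (measurableSet_singleton _)]
  congr 1
  ext y
  simp

theorem not_forall_map_eq_of_nonElementary {μ : Measure G} (hμ : NonElementary μ) (σ : Measure P1)
    [IsProbabilityMeasure σ] : ¬ ∀ g ∈ μ.support, σ.map (fun x => g • x) = σ := by
  intro hinv
  by_cases hatom : ∀ x, σ {x} = 0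
  · obtain ⟨C, hC⟩ := exists_opNorm_le_of_map_eq σ hatom
    refine hμ.2 ((isCompact_opNorm_le C).of_isClosed_subset isClosed_closure ?_)
    refine closure_minimal ?_ (isCompact_opNorm_le C).isClosed
    intro g hg
    refine hC g ?_
    induction hg using Subsemigroup.closure_induction with
    | mem g hg => exact hinv g hg
    | mul a b _ _ ha hb =>
      have hm : ∀ g : G, Measurable fun x : P1 => g • x :=
        fun g => (continuous_const_smul g).measurable
      conv_rhs => rw [← ha, ← hb, Measure.map_map (hm a) (hm b)]
      simp only [Function.comp_def, mul_smul]
  · push Not at hatom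
    obtain ⟨x, hx⟩ := hatom
    -- A finite measure has finitely many atoms at least as heavy as a given one, and invariance
    -- permutes them.
    refine hμ.1 {y | σ {x} ≤ σ {y}} ?_ ⟨x, by simp⟩ fun g hg y hy => ?_
    · exact Measure.finite_const_le_meas_of_disjoint_iUnion σ (pos_iff_ne_zero.2 hx)
        (fun y => measurableSet_singleton y)
        (fun a b hab => Set.disjoint_singleton.2 hab) (measure_ne_top _ _)
    · change σ {x} ≤ σ {g • y}
      rw [map_singleton_smul (hinv g hg)]
      exact hy

end RandomProducts

end

noncomputable section

namespace RandomProducts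

open Filter Topology Matrix

/-! ### The unitary representation on `L²(ℂ²)` and its spectral gap -/

theorem measurePreserving_mulVec (A : SL(2, ℂ)) :
    MeasurePreserving (fun v : Fin 2 → ℂ => A.1 *ᵥ v) := by
  -- The real determinant of a complex linear map is the norm from `ℂ` to `ℝ` of its complex
  -- determinant.
  have hdet : LinearMap.det ((Matrix.toLin' A.1).restrictScalars ℝ) = 1 := by
    rw [LinearMap.det_restrictScalars, LinearMap.det_toLin', A.2, map_one]
  have h := Measure.map_linearMap_addHaar_eq_smul_addHaar (volume : Measure (Fin 2 → ℂ))
    (f := (Matrix.toLin' A.1).restrictScalars ℝ) (by rw [hdet]; exact one_ne_zero)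
  rw [hdet, inv_one, abs_one, ENNReal.ofReal_one, one_smul] at h
  exact ⟨(LinearMap.continuous_of_finiteDimensional (Matrix.toLin' A.1)).measurable, h⟩

theorem measurable_mulVec (A : SL(2, ℂ)) : Measurable fun v : Fin 2 → ℂ => A.1 *ᵥ v :=
  (measurePreserving_mulVec A).measurable

theorem integral_comp_mulVec (A : SL(2, ℂ)) (f : (Fin 2 → ℂ) → ℝ) :
    ∫ v, f (A.1 *ᵥ v) = ∫ v, f v := by
  have e : MeasurableEmbedding fun v : Fin 2 → ℂ => A.1 *ᵥ v := by
    refine (measurable_mulVec A).measurableEmbedding fun v w h => ?_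
    have := congrArg (fun x => A⁻¹.1 *ᵥ x) h
    simpa only [Matrix.mulVec_mulVec, ← Matrix.SpecialLinearGroup.coe_mul, inv_mul_cancel,
      Matrix.SpecialLinearGroup.coe_one, Matrix.one_mulVec] using this
  exact (measurePreserving_mulVec A).integral_comp e f

/-- The matrix coefficient `⟨f ∘ g, f⟩` of the representation of `PSL₂(ℂ)` on the even functions
of `L²(ℂ²)`. -/
def coeff (f : (Fin 2 → ℂ) → ℝ) (g : G) : ℝ := ∫ v, f ((lift g).1 *ᵥ v) * f v

section

variable {f : (Fin 2 → ℂ) → ℝ}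

theorem integrable_sq_comp (A : SL(2, ℂ)) (hf2 : Integrable fun v => f v ^ 2) :
    Integrable fun v => f (A.1 *ᵥ v) ^ 2 :=
  (measurePreserving_mulVec A).integrable_comp_of_integrable hf2

theorem integrable_coeff (hf : Measurable f) (hf2 : Integrable fun v => f v ^ 2) (A : SL(2, ℂ)) :
    Integrable fun v => f (A.1 *ᵥ v) * f v := by
  refine ((integrable_sq_comp A hf2).add hf2).mono'
    ((hf.comp (measurable_mulVec A)).mul hf).aestronglyMeasurable (ae_of_all _ fun v => ?_)
  rw [Real.norm_eq_abs, abs_le]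
  simp only [Pi.add_apply]
  constructor <;> nlinarith [sq_nonneg (f (A.1 *ᵥ v) + f v), sq_nonneg (f (A.1 *ᵥ v) - f v),
    sq_nonneg (f (A.1 *ᵥ v)), sq_nonneg (f v)]

theorem integral_sub_sq (hf : Measurable f) (hf2 : Integrable fun v => f v ^ 2) (g : G) :
    ∫ v, (f ((lift g).1 *ᵥ v) - f v) ^ 2 = 2 * (∫ v, f v ^ 2) - 2 * coeff f g := by
  have h1 := integrable_sq_comp (lift g) hf2
  have h2 := integrable_coeff hf hf2 (lift g)
  have h3 : ∀ v, (f ((lift g).1 *ᵥ v) - f v) ^ 2 =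
      f ((lift g).1 *ᵥ v) ^ 2 + f v ^ 2 - 2 * (f ((lift g).1 *ᵥ v) * f v) := fun v => by ring
  have h4 : Integrable fun v => f ((lift g).1 *ᵥ v) ^ 2 + f v ^ 2 := h1.add hf2
  simp only [h3]
  rw [integral_sub h4 (h2.const_mul 2), integral_add h1 hf2, integral_const_mul,
    integral_comp_mulVec (lift g) fun v => f v ^ 2, coeff]
  ring

theorem coeff_le (hf : Measurable f) (hf2 : Integrable fun v => f v ^ 2) (g : G) :
    coeff f g ≤ ∫ v, f v ^ 2 := by
  have h := integral_sub_sq hf hf2 g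
  have : 0 ≤ ∫ v, (f ((lift g).1 *ᵥ v) - f v) ^ 2 := integral_nonneg fun _ => sq_nonneg _
  linarith

theorem coeff_nonneg (hf0 : ∀ v, 0 ≤ f v) (g : G) : 0 ≤ coeff f g :=
  integral_nonneg fun _ => mul_nonneg (hf0 _) (hf0 _)

theorem measurable_coeff (hf : Measurable f) : Measurable (coeff f) := by
  have : StronglyMeasurable fun p : G × (Fin 2 → ℂ) => f ((lift p.1).1 *ᵥ p.2) * f p.2 :=
    ((hf.comp measurable_lift_mulVec).mul (hf.comp measurable_snd)).stronglyMeasurable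
  exact this.integral_prod_right.measurable

theorem integrable_coeff_measure (hf : Measurable f) (hf0 : ∀ v, 0 ≤ f v)
    (hf2 : Integrable fun v => f v ^ 2) (μ : Measure G) [IsFiniteMeasure μ] :
    Integrable (coeff f) μ := by
  refine Integrable.of_bound (measurable_coeff hf).aestronglyMeasurable (∫ v, f v ^ 2)
    (ae_of_all _ fun g => ?_)
  rw [Real.norm_of_nonneg (coeff_nonneg hf0 g)]
  exact coeff_le hf hf2 g

/-- The probability measure on the projective line with density `f ^ 2`. -/
def densityMeasure (f : (Fin 2 → ℂ) → ℝ) : Measure P1 :=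
  (volume.withDensity fun v => ENNReal.ofReal (f v ^ 2)).map toP1

theorem isProbabilityMeasure_densityMeasure
    (hf2 : Integrable fun v => f v ^ 2) (h1 : ∫ v, f v ^ 2 = 1) :
    IsProbabilityMeasure (densityMeasure f) := by
  have : IsProbabilityMeasure (volume.withDensity fun v => ENNReal.ofReal (f v ^ 2)) := by
    refine ⟨?_⟩
    rw [withDensity_apply _ MeasurableSet.univ, Measure.restrict_univ,
      ← ofReal_integral_eq_lintegral_ofReal hf2 (ae_of_all _ fun v => sq_nonneg _), h1,
      ENNReal.ofReal_one]
  exact Measure.isProbabilityMeasure_map measurable_toP1.aemeasurable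

theorem integral_densityMeasure (hf : Measurable f) {ψ : P1 → ℝ} (hψ : Measurable ψ) :
    ∫ x, ψ x ∂densityMeasure f = ∫ v, ψ (toP1 v) * f v ^ 2 := by
  rw [densityMeasure, integral_map measurable_toP1.aemeasurable hψ.aestronglyMeasurable,
    integral_withDensity_eq_integral_toReal_smul (by fun_prop)
      (ae_of_all _ fun v => ENNReal.ofReal_lt_top)]
  refine integral_congr_ae (ae_of_all _ fun v => ?_)
  simp only [smul_eq_mul]
  rw [ENNReal.toReal_ofReal (sq_nonneg _), mul_comm]

/-- After a change of variables the difference is the integral of `ψ` at the image line against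
`f(v) ^ 2 - f(g v) ^ 2`. The splitting `|x² - y²| ≤ (x - y)² / (2t) + t (x² + y²)` replaces
Cauchy–Schwarz, and `∫ (f(g v) - f(v))² = 2 - 2 coeff f g`. -/
theorem abs_integral_smul_sub_le (hf : Measurable f) (hf2 : Integrable fun v => f v ^ 2)
    (h1 : ∫ v, f v ^ 2 = 1) {ψ : P1 → ℝ} (hψ : Measurable ψ) {C : ℝ} (hC : ∀ x, |ψ x| ≤ C)
    (g : G) {t : ℝ} (ht : 0 < t) :
    |∫ x, ψ (g • x) ∂densityMeasure f - ∫ x, ψ x ∂densityMeasure f| ≤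
      C * ((1 - coeff f g) / t + 2 * t) := by
  have hm : Measurable fun x : P1 => g • x := (continuous_const_smul g).measurable
  have hC0 : 0 ≤ C := (abs_nonneg _).trans (hC (toP1 0))
  have hi1 := integrable_sq_comp (lift g) hf2
  have hψ' : AEStronglyMeasurable fun v => ψ (toP1 ((lift g).1 *ᵥ v)) :=
    (hψ.comp (measurable_toP1.comp (measurable_mulVec _))).aestronglyMeasurable
  have hb : ∀ᵐ v, ‖ψ (toP1 ((lift g).1 *ᵥ v))‖ ≤ C := ae_of_all _ fun v => hC _
  have e1 : ∫ x, ψ (g • x) ∂densityMeasure f =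
      ∫ v, ψ (toP1 ((lift g).1 *ᵥ v)) * f v ^ 2 := by
    rw [integral_densityMeasure hf (ψ := fun x => ψ (g • x)) (hψ.comp hm)]
    have hne : ∀ᵐ v : Fin 2 → ℂ, v ≠ 0 := by
      simp [ae_iff]
    refine integral_congr_ae ?_
    filter_upwards [hne] with v hv
    rw [smul_toP1 g hv]
  have e2 : ∫ x, ψ x ∂densityMeasure f =
      ∫ v, ψ (toP1 ((lift g).1 *ᵥ v)) * f ((lift g).1 *ᵥ v) ^ 2 := by
    rw [integral_densityMeasure hf hψ,
      integral_comp_mulVec (lift g) fun v => ψ (toP1 v) * f v ^ 2]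
  have hsub : Integrable fun v => (f ((lift g).1 *ᵥ v) - f v) ^ 2 := by
    have h2 := integrable_coeff hf hf2 (lift g)
    refine ((hi1.add hf2).sub (h2.const_mul 2)).congr (ae_of_all _ fun v => ?_)
    simp only [Pi.add_apply, Pi.sub_apply]
    ring
  rw [e1, e2, ← integral_sub (hf2.bdd_mul hψ' hb) (hi1.bdd_mul hψ' hb)]
  have hint : Integrable fun v => C * ((f ((lift g).1 *ᵥ v) - f v) ^ 2 / (2 * t) +
      t * (f ((lift g).1 *ᵥ v) ^ 2 + f v ^ 2)) :=
    ((hsub.div_const _).add ((hi1.add hf2).const_mul t)).const_mul C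
  rw [← Real.norm_eq_abs]
  refine (norm_integral_le_of_norm_le hint (ae_of_all _ fun v => ?_)).trans_eq ?_
  · rw [← mul_sub, norm_mul]
    refine mul_le_mul (hC _) ?_ (norm_nonneg _) hC0
    generalize f ((lift g).1 *ᵥ v) = x
    generalize f v = y
    have h3 : ∀ s : ℝ, s * t ≤ (x - y) ^ 2 / 2 + t ^ 2 * (x ^ 2 + y ^ 2) →
        s ≤ (x - y) ^ 2 / (2 * t) + t * (x ^ 2 + y ^ 2) := by
      intro s hs
      rw [← sub_nonneg]
      have : (x - y) ^ 2 / (2 * t) + t * (x ^ 2 + y ^ 2) - s =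
          ((x - y) ^ 2 / 2 + t ^ 2 * (x ^ 2 + y ^ 2) - s * t) / t := by
        field_simp
      rw [this]
      exact div_nonneg (by linarith) ht.le
    rw [Real.norm_eq_abs, abs_le']
    constructor
    · apply h3
      nlinarith [sq_nonneg ((x - y) + t * (x + y)), mul_nonneg (sq_nonneg t) (sq_nonneg (x - y))]
    · apply h3
      nlinarith [sq_nonneg ((x - y) - t * (x + y)), mul_nonneg (sq_nonneg t) (sq_nonneg (x - y))]
  · have hadd : Integrable fun v => f ((lift g).1 *ᵥ v) ^ 2 + f v ^ 2 := hi1.add hf2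
    rw [integral_const_mul, integral_add (hsub.div_const _) (hadd.const_mul t),
      integral_div, integral_const_mul, integral_add hi1 hf2,
      integral_comp_mulVec (lift g) fun v => f v ^ 2, integral_sub_sq hf hf2, h1]
    field_simp
    ring

end

theorem continuous_integral_smul (σ : Measure P1) [IsFiniteMeasure σ]
    (ψ : BoundedContinuousFunction P1 ℝ) : Continuous fun g : G => ∫ x, ψ (g • x) ∂σ := by
  refine continuous_of_dominated (bound := fun _ => ‖ψ‖) (fun g => ?_) (fun g => ?_)
    (integrable_const _) ?_
  · exact (ψ.continuous.comp (continuous_const_smul g)).aestronglyMeasurable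
  · exact ae_of_all _ fun x => ψ.norm_coe_le_norm _
  · exact ae_of_all _ fun x => ψ.continuous.comp (continuous_id.smul continuous_const)

/-- An almost invariant sequence of non-negative unit vectors of `L²(ℂ²)` produces a measure on the
projective line that is invariant under the support. -/
theorem exists_invariant_of_tendsto (μ : Measure G) [IsProbabilityMeasure μ]
    (f : ℕ → (Fin 2 → ℂ) → ℝ) (hf : ∀ j, Measurable (f j)) (hf0 : ∀ j v, 0 ≤ f j v)
    (hf2 : ∀ j, Integrable fun v => f j v ^ 2) (h1 : ∀ j, ∫ v, f j v ^ 2 = 1)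
    (hlim : ∀ j : ℕ, 1 - (1 / ((j : ℝ) + 1)) ^ 2 ≤ ∫ g, coeff (f j) g ∂μ) :
    ∃ σ : Measure P1, IsProbabilityMeasure σ ∧
      ∀ g ∈ μ.support, σ.map (fun x => g • x) = σ := by
  have hp := fun j => isProbabilityMeasure_densityMeasure (hf2 j) (h1 j)
  obtain ⟨σ, -, φ, hφ, hσ⟩ := isCompact_univ.tendsto_subseq
    (X := ProbabilityMeasure P1) (x := fun j => ⟨densityMeasure (f j), hp j⟩) fun _ => Set.mem_univ _
  rw [ProbabilityMeasure.tendsto_iff_forall_integral_tendsto] at hσ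
  have hm : ∀ g : G, Measurable fun x : P1 => g • x :=
    fun g => (continuous_const_smul g).measurable
  have key : ∀ ψ : BoundedContinuousFunction P1 ℝ, ∀ g ∈ μ.support,
      ∫ x, ψ (g • x) ∂(σ : Measure P1) = ∫ x, ψ x ∂(σ : Measure P1) := by
    intro ψ
    let D : ℕ → G → ℝ := fun j g => |∫ x, ψ (g • x) ∂densityMeasure (f (φ j)) -
      ∫ x, ψ x ∂densityMeasure (f (φ j))|
    let E : G → ℝ := fun g => |∫ x, ψ (g • x) ∂(σ : Measure P1) - ∫ x, ψ x ∂(σ : Measure P1)|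
    have hbound : ∀ (τ : Measure P1) [IsProbabilityMeasure τ] (g : G),
        |∫ x, ψ (g • x) ∂τ - ∫ x, ψ x ∂τ| ≤ ‖ψ‖ + ‖ψ‖ := by
      intro τ _ g
      refine (abs_sub _ _).trans (add_le_add ?_ ?_)
      · simpa using norm_integral_le_of_norm_le_const (μ := τ)
          (ae_of_all _ fun x => ψ.norm_coe_le_norm (g • x))
      · simpa using norm_integral_le_of_norm_le_const (μ := τ)
          (ae_of_all _ fun x => ψ.norm_coe_le_norm x)
    have hEc : Continuous E :=
      ((continuous_integral_smul (σ : Measure P1) ψ).sub continuous_const).abs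
    have hDc : ∀ j, Continuous (D j) := fun j =>
      ((continuous_integral_smul (densityMeasure (f (φ j))) ψ).sub continuous_const).abs
    have hDE : ∀ g, Tendsto (fun j => D j g) atTop (𝓝 (E g)) := by
      intro g
      have a := hσ (ψ.compContinuous ⟨fun x => g • x, continuous_const_smul g⟩)
      exact (a.sub (hσ ψ)).abs
    have hI : Tendsto (fun j => ∫ g, D j g ∂μ) atTop (𝓝 (∫ g, E g ∂μ)) := by
      refine tendsto_integral_of_dominated_convergence (fun _ => ‖ψ‖ + ‖ψ‖)
        (fun j => (hDc j).aestronglyMeasurable) (integrable_const _) (fun j => ?_)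
        (ae_of_all _ hDE)
      refine ae_of_all _ fun g => ?_
      rw [Real.norm_of_nonneg (abs_nonneg _)]
      exact hbound _ g
    -- The choice `t = 1 / (φ j + 1)` balances the two error terms, since `1 - ∫ coeff ≤ t ^ 2`; the
    -- total is `3 t`.
    have hle : ∀ j, ∫ g, D j g ∂μ ≤ ‖ψ‖ * (3 * (1 / ((φ j : ℝ) + 1))) := by
      intro j
      have ht : (0 : ℝ) < 1 / ((φ j : ℝ) + 1) := Nat.one_div_pos_of_nat
      have hci := integrable_coeff_measure (hf (φ j)) (hf0 _) (hf2 _) μ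
      calc ∫ g, D j g ∂μ
          ≤ ∫ g, ‖ψ‖ * ((1 - coeff (f (φ j)) g) / (1 / ((φ j : ℝ) + 1)) +
              2 * (1 / ((φ j : ℝ) + 1))) ∂μ := by
            refine integral_mono_of_nonneg (ae_of_all _ fun g => abs_nonneg _) ?_
              (ae_of_all _ fun g => ?_)
            · exact ((((integrable_const _).sub hci).div_const _).add
                (integrable_const _)).const_mul _
            · exact abs_integral_smul_sub_le (hf _) (hf2 _) (h1 _) ψ.continuous.measurable
                (fun x => ψ.norm_coe_le_norm x) g ht
        _ = ‖ψ‖ * ((1 - ∫ g, coeff (f (φ j)) g ∂μ) / (1 / ((φ j : ℝ) + 1)) +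
              2 * (1 / ((φ j : ℝ) + 1))) := by
            have hci' : Integrable (fun g => 1 - coeff (f (φ j)) g) μ :=
              (integrable_const _).sub hci
            rw [integral_const_mul, integral_add (hci'.div_const _) (integrable_const _),
              integral_div, integral_sub (integrable_const _) hci]
            simp
        _ ≤ ‖ψ‖ * (3 * (1 / ((φ j : ℝ) + 1))) := by
            refine mul_le_mul_of_nonneg_left ?_ (norm_nonneg _)
            have h3 : (1 - ∫ g, coeff (f (φ j)) g ∂μ) / (1 / ((φ j : ℝ) + 1)) ≤
                1 / ((φ j : ℝ) + 1) := by
              rw [div_le_iff₀ ht]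
              have := hlim (φ j)
              nlinarith
            linarith
    -- The defect `E` has mean zero, so it vanishes almost everywhere, and by continuity on the
    -- whole support.
    have h0 : ∫ g, E g ∂μ = 0 := by
      refine le_antisymm ?_ (integral_nonneg fun g => abs_nonneg _)
      have hz : Tendsto (fun j => ‖ψ‖ * (3 * (1 / ((φ j : ℝ) + 1)))) atTop
          (𝓝 (‖ψ‖ * (3 * 0))) :=
        ((tendsto_one_div_add_atTop_nhds_zero_nat.comp hφ.tendsto_atTop).const_mul 3).const_mul _
      simpa using le_of_tendsto_of_tendsto' hI hz hle
    have hEi : Integrable E μ := by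
      refine Integrable.of_bound hEc.aestronglyMeasurable (‖ψ‖ + ‖ψ‖) (ae_of_all _ fun g => ?_)
      rw [Real.norm_of_nonneg (abs_nonneg _)]
      exact hbound _ g
    rw [integral_eq_zero_iff_of_nonneg (fun g => abs_nonneg _) hEi] at h0
    have hcl : IsClosed {g | E g = 0} := isClosed_eq hEc continuous_const
    intro g hg
    have : E g = 0 := Measure.support_subset_of_isClosed hcl h0 hg
    exact sub_eq_zero.1 (abs_eq_zero.1 this)
  refine ⟨σ, inferInstance, fun g hg => ?_⟩
  have : IsProbabilityMeasure ((σ : Measure P1).map fun x => g • x) :=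
    Measure.isProbabilityMeasure_map (hm g).aemeasurable
  refine ext_of_forall_integral_eq_of_IsFiniteMeasure fun ψ => ?_
  rw [integral_map (hm g).aemeasurable ψ.continuous.aestronglyMeasurable]
  exact key ψ g hg

/-- Without a gap, normalised almost invariant vectors would produce a measure invariant under the
support. Only the quadratic form is bounded, on non-negative functions; this is not yet a bound on
the norm of the averaging operator, which need not be self-adjoint. -/
theorem exists_spectral_gap {μ : Measure G} [IsProbabilityMeasure μ] (hμ : NonElementary μ) :
    ∃ δ : ℝ, 0 < δ ∧ δ < 1 ∧ ∀ f : (Fin 2 → ℂ) → ℝ, Measurable f → (∀ v, 0 ≤ f v) →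
      Integrable (fun v => f v ^ 2) → ∫ g, coeff f g ∂μ ≤ (1 - δ) * ∫ v, f v ^ 2 := by
  by_contra! hcon
  have hex : ∀ j : ℕ, ∃ f : (Fin 2 → ℂ) → ℝ, Measurable f ∧ (∀ v, 0 ≤ f v) ∧
      Integrable (fun v => f v ^ 2) ∧ ∫ v, f v ^ 2 = 1 ∧
      1 - (1 / ((j : ℝ) + 1)) ^ 2 ≤ ∫ g, coeff f g ∂μ := by
    intro j
    have hj : (0 : ℝ) < 1 / ((j : ℝ) + 1) := Nat.one_div_pos_of_nat
    have hj1 : 1 / ((j : ℝ) + 1) ≤ 1 := by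
      rw [div_le_one (by positivity)]
      linarith [(Nat.cast_nonneg j : (0 : ℝ) ≤ j)]
    -- Halving keeps the candidate gap strictly below `1` even for `j = 0`.
    obtain ⟨f, hf, hf0, hf2, hlt⟩ := hcon ((1 / ((j : ℝ) + 1)) ^ 2 / 2) (by positivity)
      (by nlinarith)
    have hmono : ∫ g, coeff f g ∂μ ≤ ∫ v, f v ^ 2 := by
      have := integral_mono (integrable_coeff_measure hf hf0 hf2 μ) (integrable_const _)
        (coeff_le hf hf2)
      simpa using this
    have hpos : 0 < ∫ v, f v ^ 2 := by
      have : 0 < (1 / ((j : ℝ) + 1)) ^ 2 / 2 := by positivity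
      rcases (integral_nonneg fun v => sq_nonneg (f v) : 0 ≤ ∫ v, f v ^ 2).eq_or_lt with h | h
      · rw [← h] at hlt hmono
        linarith
      · exact h
    set c := ∫ v, f v ^ 2 with hc
    have hsq : √c ^ 2 = c := Real.sq_sqrt hpos.le
    have hcoeff : ∀ g, coeff (fun v => f v / √c) g = coeff f g / c := by
      intro g
      simp only [coeff]
      rw [← integral_div]
      congr 1
      ext v
      rw [div_mul_div_comm, ← sq, hsq]
    refine ⟨fun v => f v / √c, hf.div_const _, fun v => div_nonneg (hf0 v) (Real.sqrt_nonneg _),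
      ?_, ?_, ?_⟩
    · simp only [div_pow]
      exact hf2.div_const _
    · simp only [div_pow]
      rw [integral_div, hsq, ← hc, div_self hpos.ne']
    · simp only [hcoeff]
      rw [integral_div, le_div_iff₀ hpos]
      nlinarith [mul_pos (pow_pos hj 2) hpos]
  choose f hf hf0 hf2 h1 hlim using hex
  obtain ⟨σ, hσ, hinv⟩ := exists_invariant_of_tendsto μ f hf hf0 hf2 h1 hlim
  exact not_forall_map_eq_of_nonElementary hμ σ hinv

end RandomProducts

end

noncomputable section

namespace RandomProducts

open Filter Topology Matrix

/-! ### Convolution powers -/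

instance isProbabilityMeasure_convPow (μ : Measure G) [IsProbabilityMeasure μ] (n : ℕ) :
    IsProbabilityMeasure (convPow μ n) := by
  induction n with
  | zero => exact Measure.dirac.isProbabilityMeasure
  | succ n ih => exact inferInstanceAs (IsProbabilityMeasure (μ.mconv (convPow μ n)))

theorem convPow_succ (μ : Measure G) (n : ℕ) : convPow μ (n + 1) = μ.mconv (convPow μ n) := rfl

theorem convPow_succ' (μ : Measure G) [IsProbabilityMeasure μ] (n : ℕ) :
    convPow μ (n + 1) = (convPow μ n).mconv μ := by
  induction n with
  | zero => rw [convPow_succ, convPow, Measure.mconv_dirac_one, Measure.dirac_one_mconv]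
  | succ n ih => rw [convPow_succ, ih, ← Measure.mconv_assoc, ← convPow_succ, ih]

theorem integral_mconv_of_bounded {α β : Measure G} [IsProbabilityMeasure α]
    [IsProbabilityMeasure β] {F : G → ℝ} (hF : Measurable F) {C : ℝ} (hC : ∀ g, |F g| ≤ C) :
    ∫ g, F g ∂(α.mconv β) = ∫ g, ∫ h, F (g * h) ∂β ∂α := by
  have hm : Measurable fun p : G × G => p.1 * p.2 := measurable_mul
  rw [Measure.mconv, integral_map hm.aemeasurable hF.aestronglyMeasurable,
    integral_prod (fun p : G × G => F (p.1 * p.2)) (Integrable.of_bound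
      (hF.comp hm).aestronglyMeasurable C (ae_of_all _ fun p => hC _))]

/-! ### Decay of the norms of the random products -/

/-- The indicator function of the unit ball of `ℂ²`. -/
def unitBump (v : Fin 2 → ℂ) : ℝ := (Metric.ball (0 : Fin 2 → ℂ) 1).indicator 1 v

theorem unitBump_nonneg (v : Fin 2 → ℂ) : 0 ≤ unitBump v :=
  Set.indicator_nonneg (fun _ _ => zero_le_one) v

theorem unitBump_le_one (v : Fin 2 → ℂ) : unitBump v ≤ 1 :=
  Set.indicator_le_self' (fun _ _ => zero_le_one) v

theorem unitBump_sq (v : Fin 2 → ℂ) : unitBump v ^ 2 = unitBump v := by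
  by_cases h : v ∈ Metric.ball (0 : Fin 2 → ℂ) 1 <;> simp [unitBump, h]

theorem measurable_unitBump : Measurable unitBump :=
  measurable_one.indicator measurableSet_ball

theorem unitBump_neg (v : Fin 2 → ℂ) : unitBump (-v) = unitBump v := by
  simp [unitBump, Set.indicator]

theorem unitBump_of_norm_lt {v : Fin 2 → ℂ} (hv : ‖v‖ < 1) : unitBump v = 1 := by
  simp [unitBump, hv]

theorem integrable_unitBump : Integrable unitBump :=
  (integrable_indicator_iff measurableSet_ball).2 (by
    simp only [Pi.one_def]
    exact integrableOn_const measure_ball_lt_top.ne)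

theorem integral_unitBump_pos : 0 < ∫ v, unitBump v := by
  unfold unitBump
  rw [integral_indicator_one measurableSet_ball]
  exact ENNReal.toReal_pos (Metric.measure_ball_pos _ _ one_pos).ne' measure_ball_lt_top.ne

/-- Evenness of the bump absorbs the sign by which `lift` fails to be multiplicative. -/
theorem unitBump_lift_mul (g h : G) (v : Fin 2 → ℂ) :
    unitBump ((lift (g * h)).1 *ᵥ v) = unitBump ((lift g).1 *ᵥ ((lift h).1 *ᵥ v)) := by
  rw [Matrix.mulVec_mulVec]
  rcases lift_mul g h with e | e
  · rw [e]; rfl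
  · rw [e, Matrix.SpecialLinearGroup.coe_neg, Matrix.neg_mulVec, unitBump_neg]; rfl

theorem measurable_lift_mulVec_left (v : Fin 2 → ℂ) : Measurable fun g : G => (lift g).1 *ᵥ v :=
  Measurable.comp (g := fun p : G × (Fin 2 → ℂ) => (lift p.1).1 *ᵥ p.2) (f := fun g => (g, v))
    measurable_lift_mulVec measurable_prodMk_right

theorem measurable_unitBump_lift_left (v : Fin 2 → ℂ) :
    Measurable fun g : G => unitBump ((lift g).1 *ᵥ v) :=
  measurable_unitBump.comp (measurable_lift_mulVec_left v)

section

variable (μ : Measure G)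

/-- The probability that the `n`-th random product maps `v` into the unit ball. -/
def bumpAverage (n : ℕ) (v : Fin 2 → ℂ) : ℝ := ∫ g, unitBump ((lift g).1 *ᵥ v) ∂(convPow μ n)

theorem measurable_unitBump_lift :
    Measurable fun p : G × (Fin 2 → ℂ) => unitBump ((lift p.1).1 *ᵥ p.2) :=
  measurable_unitBump.comp measurable_lift_mulVec

theorem measurable_bumpAverage [IsProbabilityMeasure μ] (n : ℕ) : Measurable (bumpAverage μ n) :=
  measurable_unitBump_lift.stronglyMeasurable.integral_prod_left'.measurable

theorem bumpAverage_nonneg (n : ℕ) (v : Fin 2 → ℂ) : 0 ≤ bumpAverage μ n v :=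
  integral_nonneg fun _ => unitBump_nonneg _

theorem bumpAverage_le_one [IsProbabilityMeasure μ] (n : ℕ) (v : Fin 2 → ℂ) : bumpAverage μ n v ≤ 1 := by
  have h : ∀ g, ‖unitBump ((lift g).1 *ᵥ v)‖ ≤ 1 := fun g => by
    rw [Real.norm_of_nonneg (unitBump_nonneg _)]
    exact unitBump_le_one _
  have := norm_integral_le_of_norm_le_const (μ := convPow μ n) (ae_of_all _ h)
  rw [probReal_univ, mul_one] at this
  exact (Real.le_norm_self _).trans this

theorem bumpAverage_zero (v : Fin 2 → ℂ) : bumpAverage μ 0 v = unitBump v := by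
  rw [bumpAverage, convPow, integral_dirac' _ _ (measurable_unitBump_lift_left v).stronglyMeasurable]
  rcases lift_one with e | e
  · rw [e, Matrix.SpecialLinearGroup.coe_one, Matrix.one_mulVec]
  · rw [e, Matrix.SpecialLinearGroup.coe_neg, Matrix.SpecialLinearGroup.coe_one,
      Matrix.neg_mulVec, Matrix.one_mulVec, unitBump_neg]

theorem bumpAverage_succ [IsProbabilityMeasure μ] (n : ℕ) (v : Fin 2 → ℂ) :
    bumpAverage μ (n + 1) v = ∫ h, bumpAverage μ n ((lift h).1 *ᵥ v) ∂μ := by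
  have hm := measurable_unitBump_lift_left
  have hb : ∀ w, |unitBump w| ≤ 1 := fun w => by
    rw [abs_of_nonneg (unitBump_nonneg w)]
    exact unitBump_le_one w
  rw [bumpAverage, convPow_succ', integral_mconv_of_bounded (hm v) (fun g => hb _),
    integral_integral_swap]
  · refine integral_congr_ae (ae_of_all _ fun h => ?_)
    exact integral_congr_ae (ae_of_all _ fun g => unitBump_lift_mul g h v)
  · refine Integrable.of_bound ((hm v).comp measurable_mul).aestronglyMeasurable 1
      (ae_of_all _ fun p => hb _)

theorem integrable_bumpAverage [IsProbabilityMeasure μ] (n : ℕ) : Integrable (bumpAverage μ n) := by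
  have hint : Integrable (fun p : G × (Fin 2 → ℂ) => unitBump ((lift p.1).1 *ᵥ p.2))
      ((convPow μ n).prod volume) := by
    rw [integrable_prod_iff measurable_unitBump_lift.aestronglyMeasurable]
    refine ⟨ae_of_all _ fun g =>
      (measurePreserving_mulVec (lift g)).integrable_comp_of_integrable integrable_unitBump, ?_⟩
    have : (fun g => ∫ v, ‖unitBump ((lift g).1 *ᵥ v)‖) = fun _ => ∫ v, ‖unitBump v‖ := by
      ext g
      exact integral_comp_mulVec (lift g) fun v => ‖unitBump v‖
    rw [this]
    exact integrable_const _
  exact hint.integral_prod_right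

theorem integrable_sq_of_le {f : (Fin 2 → ℂ) → ℝ} (hf : Measurable f) (hf0 : ∀ v, 0 ≤ f v)
    (hi : Integrable f) {M : ℝ} (hM : ∀ v, f v ≤ M) : Integrable fun v => f v ^ 2 := by
  refine (hi.const_mul M).mono' (hf.pow_const 2).aestronglyMeasurable (ae_of_all _ fun v => ?_)
  rw [Real.norm_of_nonneg (sq_nonneg _), sq]
  exact mul_le_mul_of_nonneg_right (hM v) (hf0 v)

theorem integral_mul_average [IsProbabilityMeasure μ] {f : (Fin 2 → ℂ) → ℝ} (hf : Measurable f) (hf0 : ∀ v, 0 ≤ f v)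
    (hi : Integrable f) {M : ℝ} (hM : ∀ v, f v ≤ M) :
    Integrable (fun v => (∫ h, f ((lift h).1 *ᵥ v) ∂μ) * f v) ∧
    ∫ v, (∫ h, f ((lift h).1 *ᵥ v) ∂μ) * f v = ∫ h, coeff f h ∂μ := by
  have hp : Integrable (fun p : G × (Fin 2 → ℂ) => f ((lift p.1).1 *ᵥ p.2) * f p.2)
      (μ.prod volume) := by
    refine ((hi.comp_snd μ).const_mul M).mono'
      ((hf.comp measurable_lift_mulVec).mul (hf.comp measurable_snd)).aestronglyMeasurable
      (ae_of_all _ fun p => ?_)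
    rw [Real.norm_of_nonneg (mul_nonneg (hf0 _) (hf0 _))]
    exact mul_le_mul_of_nonneg_right (hM _) (hf0 _)
  constructor
  · simp_rw [← integral_mul_const]
    exact hp.integral_prod_right
  · unfold coeff
    rw [integral_integral_swap hp]
    simp_rw [integral_mul_const]

/-- A resolvent argument turns the bound on the quadratic form into decay of iterates. With `P` the
averaging operator, the truncated sum `F = ∑ r ^ n P ^ n 1_B` satisfies `F ≤ 1_B + r P F`. Pairing
with `F` gives `‖F‖² ≤ ⟨1_B, F⟩ + r (1 - δ) ‖F‖²`, which bounds `‖F‖` independently of the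
truncation as long as `r (1 - δ) < 1`. Each term of the sum is at most `F`. -/
theorem exists_integral_bumpAverage_sq_le {μ : Measure G} [IsProbabilityMeasure μ]
    (hμ : NonElementary μ) :
    ∃ C r : ℝ, 0 < C ∧ 1 < r ∧ ∀ n, r ^ (2 * n) * ∫ v, bumpAverage μ n v ^ 2 ≤ C := by
  obtain ⟨δ, hδ, hδ1, hgap⟩ := exists_spectral_gap hμ
  obtain ⟨r, hr1, hr⟩ : ∃ r : ℝ, 1 < r ∧ r * (1 - δ) < 1 := by
    refine ⟨1 / (1 - δ / 2), ?_, ?_⟩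
    · rw [lt_div_iff₀ (by linarith)]; linarith
    · rw [one_div_mul_eq_div, div_lt_one (by linarith)]; linarith
  have hr0 : 0 < r := by linarith
  set c := 1 - r * (1 - δ) with hc
  have hc0 : 0 < c := by linarith
  set β := ∫ v, unitBump v with hβ
  have hβ0 : 0 < β := integral_unitBump_pos
  refine ⟨β / c ^ 2, r, by positivity, hr1, fun N => ?_⟩
  let F : (Fin 2 → ℂ) → ℝ := fun v => ∑ n ∈ Finset.range (N + 1), r ^ n * bumpAverage μ n v
  have hFm : Measurable F :=
    Finset.measurable_fun_sum _ fun n _ => (measurable_bumpAverage μ n).const_mul _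
  have hF0 : ∀ v, 0 ≤ F v := fun v =>
    Finset.sum_nonneg fun n _ => mul_nonneg (by positivity) (bumpAverage_nonneg μ n v)
  have hFi : Integrable F :=
    integrable_finsetSum _ fun n _ => (integrable_bumpAverage μ n).const_mul _
  have hFM : ∀ v, F v ≤ ∑ n ∈ Finset.range (N + 1), r ^ n := fun v => by
    refine Finset.sum_le_sum fun n _ => ?_
    exact mul_le_of_le_one_right (by positivity) (bumpAverage_le_one μ n v)
  have hF2 : Integrable fun v => F v ^ 2 := integrable_sq_of_le hFm hF0 hFi hFM
  have hrec : ∀ v, F v ≤ unitBump v + r * ∫ h, F ((lift h).1 *ᵥ v) ∂μ := by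
    intro v
    have e : ∫ h, F ((lift h).1 *ᵥ v) ∂μ =
        ∑ n ∈ Finset.range (N + 1), r ^ n * bumpAverage μ (n + 1) v := by
      simp only [F, bumpAverage_succ]
      rw [integral_finsetSum]
      · simp_rw [integral_const_mul]
      · intro n _
        refine Integrable.const_mul (Integrable.of_bound (Measurable.aestronglyMeasurable ?_) 1
          (ae_of_all _ fun h => ?_)) _
        · exact (measurable_bumpAverage μ n).comp (measurable_lift_mulVec_left v)
        · rw [Real.norm_of_nonneg (bumpAverage_nonneg μ n _)]
          exact bumpAverage_le_one μ n _
    have e2 : F v = unitBump v + r * ∑ n ∈ Finset.range N, r ^ n * bumpAverage μ (n + 1) v := by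
      simp only [F]
      rw [Finset.sum_range_succ', bumpAverage_zero, Finset.mul_sum, pow_zero, one_mul, add_comm]
      congr 1
      refine Finset.sum_congr rfl fun n _ => ?_
      ring
    rw [e, e2, Finset.sum_range_succ]
    have := mul_nonneg (pow_nonneg hr0.le N) (bumpAverage_nonneg μ (N + 1) v)
    have h3 := mul_nonneg hr0.le this
    linarith
  obtain ⟨hQi, hQ⟩ := integral_mul_average μ hFm hF0 hFi hFM
  have hgapF := hgap F hFm hF0 hF2
  have hmain : ∫ v, F v ^ 2 ≤
      (1 / (2 * c)) * β + (c / 2) * (∫ v, F v ^ 2) + r * ∫ h, coeff F h ∂μ := by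
    have hR : Integrable fun v => (1 / (2 * c)) * unitBump v + (c / 2) * F v ^ 2 :=
      (integrable_unitBump.const_mul _).add (hF2.const_mul _)
    calc ∫ v, F v ^ 2 ≤ ∫ v, (1 / (2 * c)) * unitBump v + (c / 2) * F v ^ 2 +
          r * ((∫ h, F ((lift h).1 *ᵥ v) ∂μ) * F v) := by
          refine integral_mono hF2 (hR.add (hQi.const_mul r)) fun v => ?_
          have h1 : F v * F v ≤ (unitBump v + r * ∫ h, F ((lift h).1 *ᵥ v) ∂μ) * F v :=
            mul_le_mul_of_nonneg_right (hrec v) (hF0 v)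
          -- Young's inequality with weight `c`, so that half of the available margin `c ‖F‖²` is
          -- left to absorb.
          have h2 : unitBump v * F v ≤ (1 / (2 * c)) * unitBump v + (c / 2) * F v ^ 2 := by
            have e3 : (1 / (2 * c)) * unitBump v + (c / 2) * F v ^ 2 - unitBump v * F v =
                (1 / (2 * c)) * (unitBump v - c * F v) ^ 2 := by
              have := unitBump_sq v
              field_simp
              linear_combination -this
            have : 0 ≤ (1 / (2 * c)) * (unitBump v - c * F v) ^ 2 := by positivity
            linarith
          simp only
          rw [add_mul] at h1
          nlinarith
      _ = _ := by
          rw [integral_add hR (hQi.const_mul r), integral_add (integrable_unitBump.const_mul _)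
            (hF2.const_mul _), integral_const_mul, integral_const_mul, integral_const_mul, hQ]
  have hFb : ∫ v, F v ^ 2 ≤ β / c ^ 2 := by
    have h4 := mul_le_mul_of_nonneg_left hgapF hr0.le
    have h5 : (c / 2) * ∫ v, F v ^ 2 ≤ (1 / (2 * c)) * β := by
      have : r * ((1 - δ) * ∫ v, F v ^ 2) = (1 - c) * ∫ v, F v ^ 2 := by rw [hc]; ring
      linarith
    rw [le_div_iff₀ (by positivity)]
    calc (∫ v, F v ^ 2) * c ^ 2 = 2 * c * ((c / 2) * ∫ v, F v ^ 2) := by ring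
      _ ≤ 2 * c * ((1 / (2 * c)) * β) := by gcongr
      _ = β := by field_simp
  refine le_trans ?_ hFb
  rw [← integral_const_mul]
  refine integral_mono_of_nonneg (ae_of_all _ fun v => by positivity) hF2
    (ae_of_all _ fun v => ?_)
  have h6 : r ^ N * bumpAverage μ N v ≤ F v :=
    Finset.single_le_sum (f := fun n => r ^ n * bumpAverage μ n v)
      (fun n _ => mul_nonneg (by positivity) (bumpAverage_nonneg μ n v))
      (Finset.mem_range.2 N.lt_succ_self)
  have h7 : 0 ≤ r ^ N * bumpAverage μ N v := mul_nonneg (by positivity) (bumpAverage_nonneg μ N v)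
  calc r ^ (2 * N) * bumpAverage μ N v ^ 2 = (r ^ N * bumpAverage μ N v) ^ 2 := by ring
    _ ≤ F v ^ 2 := by gcongr

end

/-- The ball of radius `1 / (2 ‖g‖)` is mapped into the unit ball. The `2` compares the hermitian
norm with the sup norm that defines the balls, and `4` is the real dimension of `ℂ²`. -/
theorem le_coeff_unitBump (g : G) :
    (∫ v, unitBump v) * (1 / (2 * opNorm g)) ^ 4 ≤ coeff unitBump g := by
  have pg := opNorm_pos g
  have hr : 0 < 1 / (2 * opNorm g) := by positivity
  have e : (∫ v, unitBump v) * (1 / (2 * opNorm g)) ^ 4 =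
      ∫ v, (Metric.ball (0 : Fin 2 → ℂ) (1 / (2 * opNorm g))).indicator 1 v := by
    unfold unitBump
    rw [integral_indicator_one measurableSet_ball, integral_indicator_one measurableSet_ball,
      measureReal_def, measureReal_def, Measure.addHaar_ball_of_pos _ _ hr, ENNReal.toReal_mul,
      ENNReal.toReal_ofReal (by positivity), mul_comm]
    congr 2
    simp [Module.finrank_pi_fintype]
  rw [e, coeff]
  refine integral_mono_of_nonneg (ae_of_all _ fun v => Set.indicator_nonneg
    (fun _ _ => zero_le_one) v) (integrable_coeff measurable_unitBump
      (by simpa only [unitBump_sq] using integrable_unitBump) (lift g)) (ae_of_all _ fun v => ?_)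
  by_cases hv : v ∈ Metric.ball (0 : Fin 2 → ℂ) (1 / (2 * opNorm g))
  · simp only [Set.indicator_of_mem hv, Pi.one_apply]
    rw [mem_ball_zero_iff, lt_div_iff₀ (by positivity)] at hv
    have h1 := one_le_opNorm g
    have h2 : ‖(lift g).1 *ᵥ v‖ < 1 := by
      calc ‖(lift g).1 *ᵥ v‖ ≤ opNorm g * hnorm v := by
            rw [opNorm_eq_lift]
            exact (norm_le_hnorm _).trans (hnorm_mulVec_le _ v)
        _ ≤ opNorm g * (2 * ‖v‖) := by gcongr; exact hnorm_le_two_norm v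
        _ < 1 := by linarith
    have h3 : ‖v‖ < 1 := by nlinarith [norm_nonneg v]
    rw [unitBump_of_norm_lt h2, unitBump_of_norm_lt h3, mul_one]
  · simp only [Set.indicator_of_notMem hv]
    exact mul_nonneg (unitBump_nonneg _) (unitBump_nonneg _)

theorem integrable_opNorm_inv (μ : Measure G) [IsProbabilityMeasure μ] (h : G) :
    Integrable (fun g => (1 / opNorm (g * h)) ^ 4) μ := by
  refine Integrable.of_bound (Measurable.aestronglyMeasurable ?_) 1 (ae_of_all _ fun g => ?_)
  · exact ((measurable_opNorm.comp (measurable_mul_const h)).const_div 1).pow_const 4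
  · have := one_le_opNorm (g * h)
    have := opNorm_pos (g * h)
    rw [Real.norm_of_nonneg (by positivity)]
    exact pow_le_one₀ (by positivity) (by rwa [div_le_one (by positivity)])

theorem measurable_unitBump_lift_mul (h : G) :
    Measurable fun p : G × (Fin 2 → ℂ) => unitBump ((lift (p.1 * h)).1 *ᵥ p.2) := by
  have h1 : Measurable fun p : G × (Fin 2 → ℂ) => p.1 * h :=
    (measurable_mul_const h).comp measurable_fst
  have hm : Measurable fun p : G × (Fin 2 → ℂ) => (p.1 * h, p.2) := h1.prodMk measurable_snd
  have e : (fun p : G × (Fin 2 → ℂ) => unitBump ((lift (p.1 * h)).1 *ᵥ p.2)) =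
      (fun p : G × (Fin 2 → ℂ) => unitBump ((lift p.1).1 *ᵥ p.2)) ∘ fun p => (p.1 * h, p.2) := rfl
  rw [e]
  exact measurable_unitBump_lift.comp hm

/-- Averaging the lower bound for the matrix coefficients gives `∫ u(h v) 1_B(v) dv`, where `u` is
the `n`-th bump average. The translation by `h` preserves the `L²` norm of `u`, hence the uniformity
in `h`. -/
theorem exists_integral_opNorm_inv_le {μ : Measure G} [IsProbabilityMeasure μ]
    (hμ : NonElementary μ) :
    ∃ C ρ : ℝ, 0 < C ∧ 0 < ρ ∧ ρ < 1 ∧ ∀ n h,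
      ∫ g, (1 / opNorm (g * h)) ^ 4 ∂(convPow μ n) ≤ C * ρ ^ n := by
  obtain ⟨C, r, hC, hr, hdecay⟩ := exists_integral_bumpAverage_sq_le hμ
  have hr0 : 0 < r := one_pos.trans hr
  set β := ∫ v, unitBump v with hβ
  have hβ0 : 0 < β := integral_unitBump_pos
  refine ⟨16 / β * ((C + β) / 2), 1 / r, by positivity, by positivity,
    by rwa [div_lt_one hr0], fun n h => ?_⟩
  have hu2 : Integrable fun v => bumpAverage μ n v ^ 2 :=
    integrable_sq_of_le (measurable_bumpAverage μ n) (bumpAverage_nonneg μ n)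
      (integrable_bumpAverage μ n) (bumpAverage_le_one μ n)
  have hp : Integrable (fun p : G × (Fin 2 → ℂ) =>
      unitBump ((lift (p.1 * h)).1 *ᵥ p.2) * unitBump p.2) ((convPow μ n).prod volume) := by
    refine (integrable_unitBump.comp_snd (convPow μ n)).mono' (Measurable.aestronglyMeasurable ?_)
      (ae_of_all _ fun p => ?_)
    · exact (measurable_unitBump_lift_mul h).mul (measurable_unitBump.comp measurable_snd)
    · rw [Real.norm_of_nonneg (mul_nonneg (unitBump_nonneg _) (unitBump_nonneg _))]
      exact mul_le_of_le_one_left (unitBump_nonneg _) (unitBump_le_one _)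
  have e1 : ∫ g, coeff unitBump (g * h) ∂(convPow μ n) =
      ∫ v, bumpAverage μ n ((lift h).1 *ᵥ v) * unitBump v := by
    unfold coeff
    rw [integral_integral_swap hp]
    simp_rw [integral_mul_const, unitBump_lift_mul]
    rfl
  have hci : Integrable (fun g => coeff unitBump (g * h)) (convPow μ n) := hp.integral_prod_left
  have h1 : β / 16 * ∫ g, (1 / opNorm (g * h)) ^ 4 ∂(convPow μ n) ≤
      ∫ g, coeff unitBump (g * h) ∂(convPow μ n) := by
    rw [← integral_const_mul]
    refine integral_mono ((integrable_opNorm_inv _ h).const_mul _) hci fun g => ?_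
    refine le_trans (le_of_eq ?_) (le_coeff_unitBump (g * h))
    have := opNorm_pos (g * h)
    rw [← hβ]
    field_simp
    ring
  -- Young's inequality with weights `r ^ n` and `r ^ (-n)` plays the part of Cauchy–Schwarz.
  have h2 : ∫ v, bumpAverage μ n ((lift h).1 *ᵥ v) * unitBump v ≤ (C + β) / 2 * (1 / r) ^ n := by
    have hi1 := integrable_sq_comp (lift h) hu2
    have hR : Integrable fun v => r ^ n / 2 * bumpAverage μ n ((lift h).1 *ᵥ v) ^ 2 +
        (1 / r) ^ n / 2 * unitBump v :=
      (hi1.const_mul _).add (integrable_unitBump.const_mul _)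
    calc ∫ v, bumpAverage μ n ((lift h).1 *ᵥ v) * unitBump v
        ≤ ∫ v, r ^ n / 2 * bumpAverage μ n ((lift h).1 *ᵥ v) ^ 2 +
            (1 / r) ^ n / 2 * unitBump v := by
          refine integral_mono_of_nonneg (ae_of_all _ fun v =>
            mul_nonneg (bumpAverage_nonneg μ n _) (unitBump_nonneg v)) hR (ae_of_all _ fun v => ?_)
          simp only
          generalize bumpAverage μ n ((lift h).1 *ᵥ v) = x
          have hsq := unitBump_sq v
          generalize unitBump v = y at hsq
          have hrn : 0 < r ^ n := by positivity
          rw [one_div, inv_pow]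
          have e3 : r ^ n / 2 * x ^ 2 + (r ^ n)⁻¹ / 2 * y - x * y =
              (r ^ n)⁻¹ / 2 * (r ^ n * x - y) ^ 2 := by
            field_simp
            linear_combination -hsq
          have : 0 ≤ (r ^ n)⁻¹ / 2 * (r ^ n * x - y) ^ 2 := by positivity
          linarith
      _ = r ^ n / 2 * (∫ v, bumpAverage μ n v ^ 2) + (1 / r) ^ n / 2 * β := by
          rw [integral_add (hi1.const_mul _) (integrable_unitBump.const_mul _), integral_const_mul,
            integral_const_mul, integral_comp_mulVec (lift h) fun v => bumpAverage μ n v ^ 2]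
      _ ≤ C / 2 * (1 / r) ^ n + (1 / r) ^ n / 2 * β := by
          have := hdecay n
          have hrn : 0 < r ^ n := by positivity
          have h5 : r ^ n * (∫ v, bumpAverage μ n v ^ 2) ≤ C * (1 / r) ^ n := by
            rw [one_div, inv_pow, ← div_eq_mul_inv, le_div_iff₀ hrn]
            calc _ = r ^ (2 * n) * (∫ v, bumpAverage μ n v ^ 2) := by ring
              _ ≤ C := this
          linarith
      _ = _ := by ring
  rw [e1] at h1
  have h3 := h1.trans h2
  calc ∫ g, (1 / opNorm (g * h)) ^ 4 ∂(convPow μ n)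
      = 16 / β * (β / 16 * ∫ g, (1 / opNorm (g * h)) ^ 4 ∂(convPow μ n)) := by field_simp
    _ ≤ 16 / β * ((C + β) / 2 * (1 / r) ^ n) := by gcongr
    _ = _ := by ring

end RandomProducts

end

noncomputable section

namespace RandomProducts

open Filter Topology Matrix

/-! ### Contraction of the random products -/

theorem exists_unimodular_representatives {x y : P1} (hxy : x ≠ y) :
    ∃ (v w : Fin 2 → ℂ) (hv : v ≠ 0) (hw : w ≠ 0), x = Projectivization.mk ℂ v hv ∧
      y = Projectivization.mk ℂ w hw ∧ hnorm v = hnorm w ∧ wedge v w = 1 := by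
  induction x using Projectivization.ind with | h v hv =>
  induction y using Projectivization.ind with | h w hw =>
  have pv := hnorm_pos hv
  have pw := hnorm_pos hw
  have hvw : wedge v w ≠ 0 := by
    intro h
    apply hxy
    rw [← dist_eq_zero, dist_mk_mk, chord_eq, h, norm_zero, zero_div]
  have cv : (hnorm v : ℂ) ≠ 0 := Complex.ofReal_ne_zero.2 pv.ne'
  have cw : (hnorm w : ℂ) ≠ 0 := Complex.ofReal_ne_zero.2 pw.ne'
  -- Rescaling both unit representatives by `c` gives them the common norm `|c|` and multiplies
  -- their wedge by `c ^ 2`.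
  obtain ⟨c, hc⟩ := IsAlgClosed.exists_pow_nat_eq ((hnorm v * hnorm w : ℂ) / wedge v w) two_pos
  have hc0 : c ≠ 0 := by
    rintro rfl
    rw [zero_pow two_ne_zero, eq_comm, div_eq_zero_iff] at hc
    rcases hc with hc | hc
    · exact mul_ne_zero cv cw hc
    · exact hvw hc
  have key : ∀ u : Fin 2 → ℂ, u ≠ 0 → hnorm ((c / hnorm u) • u) = ‖c‖ := fun u hu => by
    have pu := hnorm_pos hu
    rw [hnorm_smul, norm_div, Complex.norm_real, Real.norm_of_nonneg pu.le,
      div_mul_cancel₀ _ pu.ne']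
  refine ⟨(c / hnorm v) • v, (c / hnorm w) • w, smul_ne_zero (div_ne_zero hc0 cv) hv,
    smul_ne_zero (div_ne_zero hc0 cw) hw, ?_, ?_, by rw [key v hv, key w hw], ?_⟩
  · rw [eq_comm, Projectivization.mk_eq_mk_iff']
    exact ⟨_, rfl⟩
  · rw [eq_comm, Projectivization.mk_eq_mk_iff']
    exact ⟨_, rfl⟩
  · have e : wedge ((c / hnorm v) • v) ((c / hnorm w) • w) =
        c ^ 2 / (hnorm v * hnorm w) * wedge v w := by
      simp only [wedge, Pi.smul_apply, smul_eq_mul]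
      field_simp
    rw [e, hc]
    field_simp

/-- The images of two distinct points under `g` are close to each other as soon as `g * h` is large
for the `h` in a sequence which only depends on the two points. -/
theorem exists_dist_smul_le {x y : P1} (hxy : x ≠ y) :
    ∃ h : ℤ → G, ∀ (g : G) (K : ℕ), opNorm g ^ 2 ≤ 4 ^ K →
      ∃ k ∈ Finset.Icc (-(K : ℤ)) K, dist (g • x) (g • y) ≤ 9 * (1 / opNorm (g * h k)) ^ 2 := by
  obtain ⟨v, w, hv, hw, rfl, rfl, hvw, hone⟩ := exists_unimodular_representatives hxy
  let H : ℤ → Matrix (Fin 2) (Fin 2) ℂ := fun k =>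
    !![(2 : ℂ) ^ (-k) * v 0, (2 : ℂ) ^ k * w 0; (2 : ℂ) ^ (-k) * v 1, (2 : ℂ) ^ k * w 1]
  have hdet : ∀ k, (H k).det = 1 := by
    intro k
    have h2 : (2 : ℂ) ^ (-k) * (2 : ℂ) ^ k = 1 := by
      rw [← zpow_add₀ two_ne_zero]; simp
    simp only [H, Matrix.det_fin_two_of]
    simp only [wedge] at hone
    linear_combination (v 0 * w 1 - v 1 * w 0) * h2 + hone
  refine ⟨fun k => QuotientGroup.mk ⟨H k, hdet k⟩, fun g K hK => ?_⟩
  induction g using QuotientGroup.induction_on with | H A =>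
  rw [opNorm_mk] at hK
  have pA : 0 < matNorm A.1 := one_pos.trans_le (one_le_matNorm A)
  have pm := hnorm_pos hv
  have pX := hnorm_pos (mulVec_ne_zero A hv)
  have pY := hnorm_pos (mulVec_ne_zero A hw)
  have hX := hnorm_mulVec_le A.1 v
  have hX' := hnorm_le_mulVec A v
  have hY := hnorm_mulVec_le A.1 w
  have hY' := hnorm_le_mulVec A w
  rw [← hvw] at hY hY'
  have hdist := dist_mk_smul A hv hw
  rw [hone, norm_one] at hdist
  have hnormH : ∀ k, matNorm (A.1 * H k) ≤
      (2 : ℝ) ^ (-k) * hnorm (A.1 *ᵥ v) + (2 : ℝ) ^ k * hnorm (A.1 *ᵥ w) := by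
    intro k
    have e0 : H k *ᵥ ![1, 0] = (2 : ℂ) ^ (-k) • v := by
      ext i; fin_cases i <;> simp [H]
    have e1 : H k *ᵥ ![0, 1] = (2 : ℂ) ^ k • w := by
      ext i; fin_cases i <;> simp [H]
    refine (matNorm_le_add _).trans_eq ?_
    rw [← Matrix.mulVec_mulVec, ← Matrix.mulVec_mulVec, e0, e1, Matrix.mulVec_smul,
      Matrix.mulVec_smul, hnorm_smul, hnorm_smul]
    simp
  set X := hnorm (A.1 *ᵥ v)
  set Y := hnorm (A.1 *ᵥ w)
  -- This `k` balances the two columns of `A * H k`: their lengths `2 ^ (-k) X` and `2 ^ k Y` differ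
  -- by a factor between `1` and `4`.
  obtain ⟨k, hk1, hk2⟩ := exists_mem_Ico_zpow (x := X / Y) (y := (4 : ℝ)) (by positivity)
    (by norm_num)
  rw [le_div_iff₀ pY] at hk1
  rw [div_lt_iff₀ pY] at hk2
  -- Since `v` and `w` have equal norms, `X / Y` lies between `‖A‖ ^ (-2)` and `‖A‖ ^ 2`; this
  -- confines `k` to `[-K, K]`.
  have hXY : X ≤ (4 : ℝ) ^ K * Y := by
    calc X ≤ matNorm A.1 * (matNorm A.1 * Y) := hX.trans (by gcongr)
      _ = matNorm A.1 ^ 2 * Y := by ring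
      _ ≤ _ := by gcongr
  have hYX : Y ≤ (4 : ℝ) ^ K * X := by
    calc Y ≤ matNorm A.1 * (matNorm A.1 * X) := hY.trans (by gcongr)
      _ = matNorm A.1 ^ 2 * X := by ring
      _ ≤ _ := by gcongr
  refine ⟨k, ?_, ?_⟩
  · rw [Finset.mem_Icc]
    constructor
    · have h1 : (1 : ℝ) < (4 : ℝ) ^ ((K : ℤ) + (k + 1)) := by
        rw [zpow_add₀ (by norm_num), zpow_natCast]
        have h2 : Y < (4 : ℝ) ^ K * ((4 : ℝ) ^ (k + 1) * Y) :=
          hYX.trans_lt (by gcongr)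
        rw [← mul_assoc] at h2
        exact (lt_mul_iff_one_lt_left pY).1 h2
      have h3 : (0 : ℤ) < (K : ℤ) + (k + 1) := (one_lt_zpow_iff_right₀ (by norm_num)).1 h1
      omega
    · have h1 : (4 : ℝ) ^ k ≤ (4 : ℝ) ^ (K : ℤ) := by
        rw [zpow_natCast]
        exact le_of_mul_le_mul_right (hk1.trans hXY) pY
      exact (zpow_le_zpow_iff_right₀ (by norm_num)).1 h1
  · rw [hdist]
    have hp : (0 : ℝ) < (2 : ℝ) ^ k := by positivity
    have h4 : (4 : ℝ) ^ k = ((2 : ℝ) ^ k) ^ 2 := by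
      rw [← zpow_natCast, zpow_comm]
      norm_num
    have hN := hnormH k
    have eN : opNorm ((QuotientGroup.mk A : G) * QuotientGroup.mk ⟨H k, hdet k⟩) =
        matNorm (A.1 * H k) := rfl
    have pN := opNorm_pos ((QuotientGroup.mk A : G) * QuotientGroup.mk ⟨H k, hdet k⟩)
    rw [eN] at pN ⊢
    clear eN
    generalize matNorm (A.1 * H k) = N at hN pN
    rw [zpow_add_one₀ (by norm_num), h4] at hk2
    rw [h4] at hk1
    rw [_root_.zpow_neg] at hN
    generalize (2 : ℝ) ^ k = p at *
    have h5 : N ^ 2 ≤ 9 * (X * Y) := by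
      have h6 : p⁻¹ * X ≤ 4 * (p * Y) := by
        rw [inv_mul_le_iff₀ hp]; nlinarith
      have h7 : p * Y ≤ p⁻¹ * X := by
        rw [le_inv_mul_iff₀ hp]; nlinarith
      have h8 : X * Y = (p⁻¹ * X) * (p * Y) := by field_simp
      rw [h8]
      have h9 : 0 < p * Y := by positivity
      have h10 : N ^ 2 ≤ (p⁻¹ * X + p * Y) ^ 2 := by gcongr
      nlinarith
    rw [div_pow, one_pow, mul_one_div, div_le_div_iff₀ (by positivity) (by positivity)]
    linarith

/-! ### Logarithmic moments -/

theorem log_opNorm_nonneg (g : G) : 0 ≤ Real.log (opNorm g) := Real.log_nonneg (one_le_opNorm g)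

theorem integrable_log_opNorm_of_rpow {μ : Measure G} [IsProbabilityMeasure μ] {ε : ℝ} (hε : 0 < ε)
    (h : Integrable (fun g => Real.log (opNorm g) ^ (1 + ε)) μ) :
    Integrable (fun g => Real.log (opNorm g)) μ := by
  refine ((integrable_const 1).add h).mono' measurable_opNorm.log.aestronglyMeasurable
    (ae_of_all _ fun g => ?_)
  have h0 := log_opNorm_nonneg g
  rw [Real.norm_of_nonneg h0]
  simp only [Pi.add_apply]
  rcases le_total (Real.log (opNorm g)) 1 with h1 | h1
  · have := Real.rpow_nonneg h0 (1 + ε)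
    linarith
  · have := Real.rpow_le_rpow_of_exponent_le h1 (by linarith : (1 : ℝ) ≤ 1 + ε)
    rw [Real.rpow_one] at this
    linarith

theorem integral_log_opNorm_convPow_le {μ : Measure G} [IsProbabilityMeasure μ]
    (h : Integrable (fun g => Real.log (opNorm g)) μ) (n : ℕ) :
    Integrable (fun g => Real.log (opNorm g)) (convPow μ n) ∧
      ∫ g, Real.log (opNorm g) ∂(convPow μ n) ≤ n * ∫ g, Real.log (opNorm g) ∂μ := by
  induction n with
  | zero =>
    have h1 : opNorm 1 = 1 := by
      change matNorm (1 : SL(2, ℂ)).1 = 1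
      refine le_antisymm (matNorm_le zero_le_one fun v => ?_) (one_le_matNorm 1)
      rw [Matrix.SpecialLinearGroup.coe_one, Matrix.one_mulVec, one_mul]
    have hs : StronglyMeasurable fun g => Real.log (opNorm g) :=
      measurable_opNorm.log.stronglyMeasurable
    constructor
    · exact integrable_dirac' hs (by simp)
    · rw [convPow, integral_dirac' _ _ hs, h1]
      simp
  | succ n ih =>
    obtain ⟨ih1, ih2⟩ := ih
    have hm : Measurable fun p : G × G => p.1 * p.2 := measurable_mul
    have hF : Measurable fun g => Real.log (opNorm g) := measurable_opNorm.log
    have hsum : Integrable (fun p : G × G => Real.log (opNorm p.1) + Real.log (opNorm p.2))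
        (μ.prod (convPow μ n)) := (h.comp_fst (convPow μ n)).add (ih1.comp_snd μ)
    have hle : ∀ p : G × G, Real.log (opNorm (p.1 * p.2)) ≤
        Real.log (opNorm p.1) + Real.log (opNorm p.2) := fun p => by
      rw [← Real.log_mul (opNorm_pos _).ne' (opNorm_pos _).ne']
      exact Real.log_le_log (opNorm_pos _) (opNorm_mul_le _ _)
    have hint : Integrable (fun p : G × G => Real.log (opNorm (p.1 * p.2)))
        (μ.prod (convPow μ n)) := by
      refine hsum.mono' (hF.comp hm).aestronglyMeasurable (ae_of_all _ fun p => ?_)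
      rw [Real.norm_of_nonneg (log_opNorm_nonneg _)]
      exact hle p
    rw [convPow_succ, Measure.mconv]
    constructor
    · rw [integrable_map_measure hF.aestronglyMeasurable hm.aemeasurable]
      exact hint
    · rw [integral_map hm.aemeasurable hF.aestronglyMeasurable]
      refine (integral_mono hint hsum hle).trans ?_
      rw [integral_add (h.comp_fst (convPow μ n)) (ih1.comp_snd μ),
        integral_fun_fst (μ := μ) (ν := convPow μ n) (fun g => Real.log (opNorm g)),
        integral_fun_snd (μ := μ) (ν := convPow μ n) (fun g => Real.log (opNorm g))]
      simp only [probReal_univ, one_smul]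
      push_cast
      linarith

/-! ### Mean contraction of the chordal distance -/

theorem measurable_smul_left (x : P1) : Measurable fun g : G => g • x :=
  (continuous_id.smul continuous_const).measurable

theorem measurable_dist_smul (x y : P1) : Measurable fun g : G => dist (g • x) (g • y) :=
  (measurable_smul_left x).dist (measurable_smul_left y)

theorem integrable_dist_smul_rpow (m : Measure G) [IsFiniteMeasure m] (x y : P1) {s : ℝ}
    (hs : 0 ≤ s) : Integrable (fun g => dist (g • x) (g • y) ^ s) m := by
  refine Integrable.of_bound ((measurable_dist_smul x y).pow_const s).aestronglyMeasurable 1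
    (ae_of_all _ fun g => ?_)
  rw [Real.norm_of_nonneg (Real.rpow_nonneg dist_nonneg _)]
  exact Real.rpow_le_one dist_nonneg (dist_le_one _ _) hs

theorem integrable_dist_smul_sq (m : Measure G) [IsFiniteMeasure m] (x y : P1) :
    Integrable (fun g => dist (g • x) (g • y) ^ 2) m := by
  simpa using integrable_dist_smul_rpow m x y zero_le_two

/-- If `‖g‖ ^ 2 ≤ 4 ^ K`, one of the `2 K + 1` translates controls the distance, and the sum over
all of them bounds it. Otherwise `2 log ‖g‖ / K ≥ 1` dominates the squared distance, as in Markov's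
inequality. -/
theorem integral_dist_sq_le {μ : Measure G} [IsProbabilityMeasure μ]
    (hlog : Integrable (fun g => Real.log (opNorm g)) μ) {C ρ : ℝ}
    (hdecay : ∀ n h, ∫ g, (1 / opNorm (g * h)) ^ 4 ∂(convPow μ n) ≤ C * ρ ^ n)
    {x y : P1} (hxy : x ≠ y) (n : ℕ) {K : ℕ} (hK : 0 < K) :
    ∫ g, dist (g • x) (g • y) ^ 2 ∂(convPow μ n) ≤
      2 * (n * ∫ g, Real.log (opNorm g) ∂μ) / K + 81 * ((2 * K + 1) * (C * ρ ^ n)) := by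
  obtain ⟨h, hh⟩ := exists_dist_smul_le hxy
  obtain ⟨hl1, hl2⟩ := integral_log_opNorm_convPow_le hlog n
  have hK0 : (0 : ℝ) < K := Nat.cast_pos.2 hK
  have hs : Integrable (fun g => ∑ k ∈ Finset.Icc (-(K : ℤ)) K, (1 / opNorm (g * h k)) ^ 4)
      (convPow μ n) := integrable_finsetSum _ fun k _ => integrable_opNorm_inv _ (h k)
  have hpt : ∀ g : G, dist (g • x) (g • y) ^ 2 ≤ 2 / K * Real.log (opNorm g) +
      81 * ∑ k ∈ Finset.Icc (-(K : ℤ)) K, (1 / opNorm (g * h k)) ^ 4 := by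
    intro g
    have hnn : ∀ k, 0 ≤ (1 / opNorm (g * h k)) ^ 4 := fun k => by
      have := opNorm_pos (g * h k)
      positivity
    have hl := log_opNorm_nonneg g
    by_cases hg : opNorm g ^ 2 ≤ 4 ^ K
    · obtain ⟨k, hk, hd⟩ := hh g K hg
      have h1 : (1 / opNorm (g * h k)) ^ 4 ≤
          ∑ k ∈ Finset.Icc (-(K : ℤ)) K, (1 / opNorm (g * h k)) ^ 4 :=
        Finset.single_le_sum (f := fun k => (1 / opNorm (g * h k)) ^ 4) (fun k _ => hnn k) hk
      have h2 : dist (g • x) (g • y) ^ 2 ≤ (9 * (1 / opNorm (g * h k)) ^ 2) ^ 2 := by gcongr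
      have h3 : 0 ≤ 2 / K * Real.log (opNorm g) := by positivity
      nlinarith
    · push Not at hg
      have h1 : (K : ℝ) ≤ 2 * Real.log (opNorm g) := by
        have h2 := Real.log_le_log (by positivity) hg.le
        rw [Real.log_pow, Real.log_pow] at h2
        have h3 : 1 ≤ Real.log 4 := by
          rw [show (4 : ℝ) = 2 ^ 2 by norm_num, Real.log_pow]
          have := Real.log_two_gt_d9
          push_cast
          linarith
        push_cast at h2
        nlinarith
      have h4 : 1 ≤ 2 / K * Real.log (opNorm g) := by
        rw [div_mul_eq_mul_div, le_div_iff₀ hK0]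
        linarith
      have h5 : dist (g • x) (g • y) ^ 2 ≤ 1 := pow_le_one₀ dist_nonneg (dist_le_one _ _)
      have h6 : 0 ≤ ∑ k ∈ Finset.Icc (-(K : ℤ)) K, (1 / opNorm (g * h k)) ^ 4 :=
        Finset.sum_nonneg fun k _ => hnn k
      linarith
  have hR : Integrable (fun g => 2 / K * Real.log (opNorm g) +
      81 * ∑ k ∈ Finset.Icc (-(K : ℤ)) K, (1 / opNorm (g * h k)) ^ 4) (convPow μ n) :=
    (hl1.const_mul _).add (hs.const_mul _)
  refine (integral_mono (integrable_dist_smul_sq _ x y) hR hpt).trans ?_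
  rw [integral_add (hl1.const_mul _) (hs.const_mul _), integral_const_mul, integral_const_mul,
    integral_finsetSum _ fun k _ => integrable_opNorm_inv _ (h k)]
  gcongr
  · rw [div_mul_eq_mul_div]
    gcongr
  · refine (Finset.sum_le_card_nsmul _ _ _ fun k _ => hdecay n (h k)).trans_eq ?_
    have hcard : (Finset.Icc (-(K : ℤ)) K).card = 2 * K + 1 := by
      rw [Int.card_Icc]; omega
    rw [nsmul_eq_mul, hcard]
    push_cast
    ring

theorem exists_integral_dist_sq_le {μ : Measure G} [IsProbabilityMeasure μ]
    (hμ : NonElementary μ) (hlog : Integrable (fun g => Real.log (opNorm g)) μ) :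
    ∃ C q : ℝ, 0 < C ∧ 0 < q ∧ q < 1 ∧ ∀ (n : ℕ) (x y : P1),
      ∫ g, dist (g • x) (g • y) ^ 2 ∂(convPow μ n) ≤ C * q ^ n := by
  obtain ⟨C, ρ, hC, hρ0, hρ1, hdecay⟩ := exists_integral_opNorm_inv_le hμ
  set M := ∫ g, Real.log (opNorm g) ∂μ
  have hM : 0 ≤ M := integral_nonneg log_opNorm_nonneg
  -- With `K` of order `q ^ (-2n)` and `ρ = q ^ 4`, the terms `n / K` and `K ρ ^ n` are of order `n
  -- q ^ (2n)` and `q ^ (2n)`; one factor `q ^ n` is spent on absorbing `n`.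
  obtain ⟨q, hq0, hq1, hq⟩ : ∃ q : ℝ, 0 < q ∧ q < 1 ∧ q ^ 4 = ρ := by
    refine ⟨√(√ρ), by positivity, ?_, ?_⟩
    · rw [Real.sqrt_lt' one_pos, one_pow, Real.sqrt_lt' one_pos, one_pow]
      exact hρ1
    · rw [show (4 : ℕ) = 2 * 2 from rfl, pow_mul, Real.sq_sqrt (by positivity),
        Real.sq_sqrt hρ0.le]
  obtain ⟨B, hB⟩ : ∃ B : ℝ, ∀ n : ℕ, n * q ^ n ≤ B := by
    obtain ⟨B, hB⟩ := (tendsto_self_mul_const_pow_of_lt_one hq0.le hq1).bddAbove_range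
    exact ⟨B, fun n => hB ⟨n, rfl⟩⟩
  have hB0 : 0 ≤ B := by simpa using hB 0
  refine ⟨2 * M * B + 405 * C, q, by positivity, hq0, hq1, fun n x y => ?_⟩
  have hqn : 0 < q ^ n := by positivity
  have hqn1 : q ^ n ≤ 1 := pow_le_one₀ hq0.le hq1.le
  rcases eq_or_ne x y with rfl | hxy
  · simp
    positivity
  have hinv : 1 ≤ 1 / (q ^ n) ^ 2 := by
    rw [le_div_iff₀ (by positivity)]
    nlinarith
  set K := ⌈1 / (q ^ n) ^ 2⌉₊ with hKdef
  have hK1 : 1 / (q ^ n) ^ 2 ≤ K := Nat.le_ceil _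
  have hK2 : (K : ℝ) < 1 / (q ^ n) ^ 2 + 1 := Nat.ceil_lt_add_one (by positivity)
  have hK0 : (0 : ℝ) < K := by linarith
  refine (integral_dist_sq_le hlog hdecay hxy n (Nat.cast_pos.1 hK0)).trans ?_
  have h1 : 2 * (n * M) / K ≤ 2 * M * B * q ^ n := by
    rw [div_le_iff₀ hK0]
    rw [div_le_iff₀ (by positivity)] at hK1
    have h2 : (n : ℝ) ≤ B * q ^ n * K := by
      calc (n : ℝ) ≤ n * (K * (q ^ n) ^ 2) := le_mul_of_one_le_right (Nat.cast_nonneg n) hK1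
        _ = (n * q ^ n) * (q ^ n * K) := by ring
        _ ≤ B * (q ^ n * K) := by gcongr; exact hB n
        _ = _ := by ring
    calc 2 * (n * M) ≤ 2 * (B * q ^ n * K * M) := by gcongr
      _ = _ := by ring
  have h3 : 81 * ((2 * (K : ℝ) + 1) * (C * ρ ^ n)) ≤ 405 * C * q ^ n := by
    have h4 : 2 * (K : ℝ) + 1 ≤ 5 * (1 / (q ^ n) ^ 2) := by linarith
    have h5 : ρ ^ n = (q ^ n) ^ 4 := by rw [← hq]; ring
    calc 81 * ((2 * (K : ℝ) + 1) * (C * ρ ^ n))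
        ≤ 81 * (5 * (1 / (q ^ n) ^ 2) * (C * (q ^ n) ^ 4)) := by rw [h5]; gcongr
      _ = 405 * C * (q ^ n * q ^ n) := by field_simp; ring
      _ ≤ 405 * C * (q ^ n * 1) := by gcongr
      _ = _ := by ring
  linarith

/-- Jensen's inequality for the concave power `β / 2`. -/
theorem integral_dist_rpow_le {m : Measure G} [IsProbabilityMeasure m] (x y : P1) {β : ℝ}
    (hβ0 : 0 < β) (hβ1 : β ≤ 1) :
    ∫ g, dist (g • x) (g • y) ^ β ∂m ≤ (∫ g, dist (g • x) (g • y) ^ 2 ∂m) ^ (β / 2) := by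
  have e : ∀ g : G, dist (g • x) (g • y) ^ β = (dist (g • x) (g • y) ^ 2) ^ (β / 2) := by
    intro g
    rw [← Real.rpow_natCast, ← Real.rpow_mul dist_nonneg]
    congr 1
    push_cast
    ring
  have hi := integrable_dist_smul_rpow m x y hβ0.le
  simp only [e] at hi ⊢
  exact (Real.concaveOn_rpow (by positivity) (by linarith)).le_map_integral
    (Real.continuous_rpow_const (by positivity)).continuousOn isClosed_Ici
    (ae_of_all _ fun g => Set.mem_Ici.2 (sq_nonneg _)) (integrable_dist_smul_sq m x y) hi

end RandomProducts

end

noncomputable section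

namespace RandomProducts

open Filter Topology

/-! ### Stationary measures -/

instance isProbabilityMeasure_push (m : Measure G) [IsProbabilityMeasure m] (τ : Measure P1)
    [IsProbabilityMeasure τ] : IsProbabilityMeasure (push m τ) :=
  Measure.isProbabilityMeasure_map measurable_smul_prod.aemeasurable

section

variable {E : Type*} [NormedAddCommGroup E]

theorem exists_norm_le_of_continuous {φ : P1 → E} (hφ : Continuous φ) : ∃ C, ∀ x, ‖φ x‖ ≤ C := by
  obtain ⟨C, hC⟩ := isCompact_univ.exists_bound_of_continuousOn hφ.continuousOn
  exact ⟨C, fun x => hC x (Set.mem_univ x)⟩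

theorem integrable_of_continuous {φ : P1 → E} (hφ : Continuous φ) (τ : Measure P1)
    [IsFiniteMeasure τ] : Integrable φ τ := by
  obtain ⟨C, hC⟩ := exists_norm_le_of_continuous hφ
  exact Integrable.of_bound hφ.aestronglyMeasurable C (ae_of_all _ hC)

theorem integrable_comp_smul {φ : P1 → E} (hφ : Continuous φ) (m : Measure G) [IsFiniteMeasure m]
    (τ : Measure P1) [IsFiniteMeasure τ] :
    Integrable (fun p : G × P1 => φ (p.1 • p.2)) (m.prod τ) := by
  obtain ⟨C, hC⟩ := exists_norm_le_of_continuous hφ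
  exact Integrable.of_bound (hφ.comp continuous_smul).aestronglyMeasurable C
    (ae_of_all _ fun p => hC _)

theorem integrable_smul_left {φ : P1 → E} (hφ : Continuous φ) (m : Measure G) [IsFiniteMeasure m]
    (x : P1) : Integrable (fun g : G => φ (g • x)) m := by
  obtain ⟨C, hC⟩ := exists_norm_le_of_continuous hφ
  exact Integrable.of_bound (hφ.comp (continuous_id.smul continuous_const)).aestronglyMeasurable C
    (ae_of_all _ fun p => hC _)

variable [NormedSpace ℝ E]

theorem continuous_average {φ : P1 → E} (hφ : Continuous φ) (m : Measure G) [IsFiniteMeasure m] :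
    Continuous fun x => ∫ g, φ (g • x) ∂m := by
  obtain ⟨C, hC⟩ := exists_norm_le_of_continuous hφ
  refine continuous_of_dominated (bound := fun _ => C) (fun x => ?_) (fun x => ?_)
    (integrable_const _) ?_
  · exact (integrable_smul_left hφ m x).aestronglyMeasurable
  · exact ae_of_all _ fun g => hC _
  · exact ae_of_all _ fun g => hφ.comp (continuous_const_smul g)

theorem integral_push {φ : P1 → E} (hφ : Continuous φ) (m : Measure G) [IsFiniteMeasure m]
    (τ : Measure P1) [IsFiniteMeasure τ] :
    ∫ x, φ x ∂(push m τ) = ∫ x, ∫ g, φ (g • x) ∂m ∂τ := by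
  rw [push, integral_map measurable_smul_prod.aemeasurable hφ.aestronglyMeasurable,
    integral_prod_symm _ (integrable_comp_smul hφ m τ)]

end

theorem push_mconv (α β : Measure G) [IsProbabilityMeasure α] [IsProbabilityMeasure β]
    (τ : Measure P1) [IsProbabilityMeasure τ] :
    push (α.mconv β) τ = push α (push β τ) := by
  refine ext_of_forall_integral_eq_of_IsFiniteMeasure fun ψ => ?_
  rw [integral_push ψ.continuous, integral_push ψ.continuous,
    integral_push (continuous_average ψ.continuous α)]
  refine integral_congr_ae (ae_of_all _ fun x => ?_)
  simp only
  rw [integral_mconv_of_bounded (F := fun g => ψ (g • x)) (C := ‖ψ‖)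
    (ψ.continuous.comp (continuous_id.smul continuous_const)).measurable
    fun g => ψ.norm_coe_le_norm _, integral_integral_swap]
  · simp only [mul_smul]
  · exact Integrable.of_bound (ψ.continuous.comp
      (continuous_mul.smul continuous_const)).aestronglyMeasurable ‖ψ‖
      (ae_of_all _ fun p => ψ.norm_coe_le_norm _)

theorem push_convPow_of_isStationary {μ : Measure G} [IsProbabilityMeasure μ] {τ : Measure P1}
    [IsProbabilityMeasure τ] (hτ : IsStationary μ τ) (n : ℕ) : push (convPow μ n) τ = τ := by
  induction n with
  | zero =>
    refine ext_of_forall_integral_eq_of_IsFiniteMeasure fun ψ => ?_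
    rw [integral_push ψ.continuous]
    refine integral_congr_ae (ae_of_all _ fun x => ?_)
    have hs : StronglyMeasurable fun g : G => ψ (g • x) :=
      (ψ.continuous.comp (continuous_id.smul continuous_const)).stronglyMeasurable
    simp only [convPow]
    rw [integral_dirac' _ _ hs, one_smul]
  | succ n ih => rw [convPow_succ, push_mconv, ih, hτ]

/-- Lipschitz functions determine weak convergence, so the constant sequence `τ` converges to `τ'`,
and the weak topology is Hausdorff. -/
theorem eq_of_forall_lipschitz {τ τ' : Measure P1} [h : IsProbabilityMeasure τ]
    [h' : IsProbabilityMeasure τ']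
    (heq : ∀ f : P1 → ℝ, (∃ L : ℝ≥0, LipschitzWith L f) → ∫ x, f x ∂τ = ∫ x, f x ∂τ') :
    τ = τ' := by
  let p : ProbabilityMeasure P1 := ⟨τ, h⟩
  let p' : ProbabilityMeasure P1 := ⟨τ', h'⟩
  have hlim : Tendsto (fun _ : ℕ => p) atTop (𝓝 p') := by
    rw [tendsto_iff_forall_lipschitz_integral_tendsto]
    intro f _ hf
    change Tendsto (fun _ : ℕ => ∫ x, f x ∂τ) atTop (𝓝 (∫ x, f x ∂τ'))
    rw [heq f hf]
    exact tendsto_const_nhds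
  exact congrArg (fun p : ProbabilityMeasure P1 => (p : Measure P1))
    (tendsto_nhds_unique tendsto_const_nhds hlim)

/-- The mean contraction of the random products in the exponent `β`. -/
theorem norm_integral_push_sub_le {E : Type*} [NormedAddCommGroup E] [NormedSpace ℝ E]
    {m : Measure G} [IsProbabilityMeasure m] {D : ℝ}
    (hD : ∀ x y : P1, ∫ g, dist (g • x) (g • y) ^ 2 ∂m ≤ D) {β : ℝ} (hβ0 : 0 < β) (hβ1 : β ≤ 1)
    {φ : P1 → E} (hφ : Continuous φ) {L : ℝ} (hL0 : 0 ≤ L)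
    (hL : ∀ x y, ‖φ x - φ y‖ ≤ L * dist x y ^ β) (τ τ' : Measure P1) [IsProbabilityMeasure τ]
    [IsProbabilityMeasure τ'] :
    ‖∫ x, φ x ∂(push m τ) - ∫ x, φ x ∂(push m τ')‖ ≤ L * D ^ (β / 2) := by
  rw [integral_push hφ, integral_push hφ]
  have hc := continuous_average hφ m
  set u : P1 → E := fun x => ∫ g, φ (g • x) ∂m
  have hu : ∀ x y, ‖u x - u y‖ ≤ L * D ^ (β / 2) := by
    intro x y
    simp only [u]
    rw [← integral_sub (integrable_smul_left hφ m x) (integrable_smul_left hφ m y)]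
    refine (norm_integral_le_of_norm_le ((integrable_dist_smul_rpow m x y hβ0.le).const_mul L)
      (ae_of_all _ fun g => hL _ _)).trans ?_
    rw [integral_const_mul]
    refine mul_le_mul_of_nonneg_left ((integral_dist_rpow_le x y hβ0 hβ1).trans ?_) hL0
    exact Real.rpow_le_rpow (integral_nonneg fun g => sq_nonneg _) (hD x y) (by positivity)
  have h1 : ∀ x, ‖u x - ∫ y, u y ∂τ'‖ ≤ L * D ^ (β / 2) := by
    intro x
    have e : u x - ∫ y, u y ∂τ' = ∫ y, (u x - u y) ∂τ' := by
      -- In a space that is not complete, Bochner integrals are zero by convention and both sides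
      -- vanish.
      by_cases hE : CompleteSpace E
      · rw [integral_sub (integrable_const _) (integrable_of_continuous hc τ'), integral_const,
          probReal_univ, one_smul]
      · simp [u, integral_of_not_completeSpace hE]
    rw [e]
    simpa using norm_integral_le_of_norm_le_const (μ := τ') (ae_of_all _ fun y => hu x y)
  have e : ∫ x, u x ∂τ - ∫ y, u y ∂τ' = ∫ x, (u x - ∫ y, u y ∂τ') ∂τ := by
    by_cases hE : CompleteSpace E
    · rw [integral_sub (integrable_of_continuous hc τ) (integrable_const _), integral_const,
        probReal_univ, one_smul]
    · simp [integral_of_not_completeSpace hE]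
  rw [e]
  simpa using norm_integral_le_of_norm_le_const (μ := τ) (ae_of_all _ h1)

theorem tendsto_rpow_geometric (C : ℝ) {q : ℝ} (hq0 : 0 < q) (hq1 : q < 1) (L : ℝ) :
    Tendsto (fun n : ℕ => L * (C * q ^ n) ^ ((1 : ℝ) / 2)) atTop (𝓝 0) := by
  have h1 : Tendsto (fun n : ℕ => C * q ^ n) atTop (𝓝 (C * 0)) :=
    (tendsto_pow_atTop_nhds_zero_of_lt_one hq0.le hq1).const_mul C
  have h2 := ((Real.continuous_rpow_const (q := (1 : ℝ) / 2) (by norm_num)).tendsto _).comp h1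
  rw [mul_zero, Real.zero_rpow (by norm_num)] at h2
  simpa using h2.const_mul L

section

variable {μ : Measure G} [IsProbabilityMeasure μ] {C q : ℝ}

/-- Both measures are fixed by every convolution power, while their images under the `n`-th power
come together on Lipschitz functions. -/
theorem eq_of_isStationary (hq0 : 0 < q) (hq1 : q < 1)
    (hcontr : ∀ (n : ℕ) (x y : P1), ∫ g, dist (g • x) (g • y) ^ 2 ∂(convPow μ n) ≤ C * q ^ n)
    {ν ν' : Measure P1} [IsProbabilityMeasure ν] [IsProbabilityMeasure ν']
    (hν : IsStationary μ ν) (hν' : IsStationary μ ν') : ν = ν' := by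
  refine eq_of_forall_lipschitz fun f ⟨L, hL⟩ => ?_
  have hle : ∀ n : ℕ, ‖∫ x, f x ∂ν - ∫ x, f x ∂ν'‖ ≤ L * (C * q ^ n) ^ ((1 : ℝ) / 2) := by
    intro n
    have := norm_integral_push_sub_le (hcontr n) one_pos le_rfl hL.continuous L.2
      (fun x y => by simpa [dist_eq_norm] using hL.dist_le_mul x y) ν ν'
    rwa [push_convPow_of_isStationary hν, push_convPow_of_isStationary hν'] at this
  have h0 := ge_of_tendsto' (tendsto_rpow_geometric C hq0 hq1 L) hle
  exact sub_eq_zero.1 (norm_le_zero_iff.1 h0)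

/-- A weak limit of `μ^{*n} * δ` along a subsequence is stationary without Cesàro averaging: the
contraction makes `μ^{*n} * (μ * δ)` and `μ^{*n} * δ` asymptotic. -/
theorem exists_isStationary (hq0 : 0 < q) (hq1 : q < 1)
    (hcontr : ∀ (n : ℕ) (x y : P1), ∫ g, dist (g • x) (g • y) ^ 2 ∂(convPow μ n) ≤ C * q ^ n) :
    ∃ ν : Measure P1, IsProbabilityMeasure ν ∧ IsStationary μ ν := by
  -- The base point is arbitrary; `toP1 0` is the default line.
  let δ : Measure P1 := Measure.dirac (toP1 0)
  let N : ℕ → ProbabilityMeasure P1 := fun n => ⟨push (convPow μ n) δ, inferInstance⟩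
  obtain ⟨ν, -, φ, hφ, hν⟩ := isCompact_univ.tendsto_subseq
    (X := ProbabilityMeasure P1) (x := N) fun _ => Set.mem_univ _
  rw [ProbabilityMeasure.tendsto_iff_forall_integral_tendsto] at hν
  refine ⟨ν, inferInstance, eq_of_forall_lipschitz fun f ⟨L, hL⟩ => ?_⟩
  have hlim : ∀ f : P1 → ℝ, Continuous f → Tendsto (fun j => ∫ x, f x ∂(push (convPow μ (φ j)) δ))
      atTop (𝓝 (∫ x, f x ∂(ν : Measure P1))) := fun f hf =>
    hν (BoundedContinuousFunction.mkOfCompact ⟨f, hf⟩)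
  have h1 := hlim f hL.continuous
  have h2 := hlim _ (continuous_average hL.continuous μ)
  rw [← integral_push hL.continuous] at h2
  have h3 : Tendsto (fun j => ∫ x, f x ∂(push (convPow μ (φ j)) (push μ δ)) -
      ∫ x, f x ∂(push (convPow μ (φ j)) δ)) atTop (𝓝 0) := by
    refine squeeze_zero_norm (fun j => ?_)
      ((tendsto_rpow_geometric C hq0 hq1 L).comp hφ.tendsto_atTop)
    exact norm_integral_push_sub_le (hcontr (φ j)) one_pos le_rfl hL.continuous L.2
      (fun x y => by simpa [dist_eq_norm] using hL.dist_le_mul x y) _ _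
  have h4 := h1.add h3
  rw [add_zero] at h4
  refine tendsto_nhds_unique h2 (h4.congr fun j => ?_)
  -- Convolution powers of `μ` commute with `μ`, so an extra factor on the left may be moved to the
  -- right.
  rw [← integral_push hL.continuous, ← push_mconv, ← push_mconv, ← convPow_succ, ← convPow_succ']
  ring

theorem norm_integral_push_dirac_sub_le (hC : 0 < C) (hq0 : 0 < q)
    (hcontr : ∀ (n : ℕ) (x y : P1), ∫ g, dist (g • x) (g • y) ^ 2 ∂(convPow μ n) ≤ C * q ^ n)
    {ν : Measure P1} [IsProbabilityMeasure ν] (hν : IsStationary μ ν) {β : ℝ≥0} (hβ0 : 0 < β)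
    (hβ1 : β ≤ 1) (a : P1) {φ : P1 → ℂ} (hφ : MemHolder β φ) (n : ℕ) :
    ‖(∫ x, φ x ∂(push (convPow μ n) (Measure.dirac a))) - ∫ x, φ x ∂ν‖ ≤
      C ^ ((β : ℝ) / 2) * holderNorm β φ * (√q) ^ ((β : ℝ) * (n : ℝ)) := by
  have hL : ∀ x y, ‖φ x - φ y‖ ≤ nnHolderNorm β φ * dist x y ^ (β : ℝ) := fun x y => by
    simpa [dist_eq_norm] using hφ.holderWith.dist_le x y
  have h := norm_integral_push_sub_le (hcontr n) (NNReal.coe_pos.2 hβ0)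
    (by exact_mod_cast hβ1) (hφ.holderWith.continuous hβ0) (nnHolderNorm β φ).2 hL
    (Measure.dirac a) ν
  rw [push_convPow_of_isStationary hν] at h
  refine h.trans ?_
  have e : (C * q ^ n) ^ ((β : ℝ) / 2) = C ^ ((β : ℝ) / 2) * (√q) ^ ((β : ℝ) * (n : ℝ)) := by
    rw [Real.mul_rpow hC.le (by positivity), Real.sqrt_eq_rpow, ← Real.rpow_natCast,
      ← Real.rpow_mul hq0.le, ← Real.rpow_mul hq0.le]
    congr 2
    ring
  have hn : (nnHolderNorm β φ : ℝ) ≤ holderNorm β φ :=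
    le_add_of_nonneg_left (Real.iSup_nonneg fun x => norm_nonneg _)
  rw [e]
  calc (nnHolderNorm β φ : ℝ) * (C ^ ((β : ℝ) / 2) * (√q) ^ ((β : ℝ) * (n : ℝ)))
      ≤ holderNorm β φ * (C ^ ((β : ℝ) / 2) * (√q) ^ ((β : ℝ) * (n : ℝ))) := by gcongr
    _ = _ := by ring

end

end RandomProducts

end

theorem mainTheorem3
    (μ : Measure RandomProducts.G) [IsProbabilityMeasure μ]
    (hμ : RandomProducts.NonElementary μ)
    (ε : ℝ) (hε : 0 < ε)
    (hmom : Integrable (fun g => Real.log (RandomProducts.opNorm g) ^ (1 + ε)) μ) :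
    ∃ ν : Measure RandomProducts.P1,
      IsProbabilityMeasure ν ∧ RandomProducts.IsStationary μ ν ∧
      (∀ ν' : Measure RandomProducts.P1, IsProbabilityMeasure ν' →
        RandomProducts.IsStationary μ ν' → ν' = ν) ∧
      ∃ γ : ℝ, 0 < γ ∧ γ < 1 ∧
        ∀ β : ℝ≥0, 0 < β → β ≤ 1 →
          ∃ A : ℝ, 0 < A ∧
            ∀ (a : RandomProducts.P1) (φ : RandomProducts.P1 → ℂ), MemHolder β φ →
              ∀ n : ℕ,
                ‖(∫ x, φ x ∂(RandomProducts.push (RandomProducts.convPow μ n)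
                    (Measure.dirac a))) - ∫ x, φ x ∂ν‖
                  ≤ A * RandomProducts.holderNorm β φ * γ ^ ((β : ℝ) * (n : ℝ)) := by
  obtain ⟨C, q, hC, hq0, hq1, hcontr⟩ := RandomProducts.exists_integral_dist_sq_le hμ
    (RandomProducts.integrable_log_opNorm_of_rpow hε hmom)
  obtain ⟨ν, hνp, hν⟩ := RandomProducts.exists_isStationary hq0 hq1 hcontr
  refine ⟨ν, hνp, hν, fun ν' hp hν' =>
    RandomProducts.eq_of_isStationary hq0 hq1 hcontr hν' hν, √q, Real.sqrt_pos.2 hq0, ?_, ?_⟩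
  · rw [Real.sqrt_lt' one_pos, one_pow]
    exact hq1
  · intro β hβ0 hβ1
    exact ⟨C ^ ((β : ℝ) / 2), by positivity, fun a φ hφ n =>
      RandomProducts.norm_integral_push_dirac_sub_le hC hq0 hcontr hν hβ0 hβ1 a hφ n⟩
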